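/- Let $d\ge 1$, let $1<p<\infty$ if $d\le 2$ and $1<p<\frac{d+2}{d-2}$ if $d\ge 3$, and let $\beta>0$. Let $V:\mathbb{R}^d\to[0,\infty)$ be measurable with $V(\mathbf{x})\to\infty$ as $|\mathbf{x}|\to\infty$. Let $L_z=i(x_2\partial_{x_1}-x_1\partial_{x_2})$ if $d\ge 2$ and $L_z=0$ if $d=1$, and let $$\Omega_{\max}=\sup\Big\{\gamma>0:\ \lim_{|\mathbf{x}|\to\infty}\Big(V(\mathbf{x})-\tfrac{\gamma^2}{2}(x_1^2+x_2^2)\Big)=\infty\Big\}\le\infty ,$$ where $x_1^2+x_2^2$ is replaced by $0$ if $d=1$. Let $\Omega\in\mathbb{R}$ satisfy either $\Omega=0$ or $0<|\Omega|<\Omega_{\max}$. Let $X=\{\phi\in H^1(\mathbb{R}^d;\mathbb{C}):\int_{\mathbb{R}^d} V|\phi|^2\,\mathrm{d}\mathbf{x}<\infty\}$ and, for $\phi\in X$ and $\omega\in\mathbb{R}$, $$S_{\Omega,\omega}(\phi)=\tfrac12\|\nabla\phi\|_{L^2}^2+\int_{\mathbb{R}^d}V|\phi|^2\,\mathrm{d}\mathbf{x}+\tfrac{2\beta}{p+1}\|\phi\|_{L^{p+1}}^{p+1}-\Omega\int_{\mathbb{R}^d}\overline{\phi}\,L_z\phi\,\mathrm{d}\mathbf{x}+\omega\|\phi\|_{L^2}^2,$$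 $$\lambda_0(\Omega)=\inf_{0\ne\phi\in X}\frac{\tfrac12\|\nabla\phi\|_{L^2}^2+\int_{\mathbb{R}^d}V|\phi|^2\,\mathrm{d}\mathbf{x}-\Omega\int_{\mathbb{R}^d}\overline{\phi}\,L_z\phi\,\mathrm{d}\mathbf{x}}{\|\phi\|_{L^2}^2}\qquad(\inf\emptyset=\infty).$$ Let $\mathcal{A}_{\Omega,\omega}$ be the set of action ground states, that is, of the minimizers of $S_{\Omega,\omega}$ among all $\phi\in X\setminus\{0\}$ that solve $$-\tfrac12\Delta\phi+V\phi+\beta|\phi|^{p-1}\phi-\Omega L_z\phi+\omega\phi=0$$ weakly (tested against all functions in $X$), let $\mathcal{N}_{\Omega,\omega}=\{\|\phi\|_{L^2}^2:\phi\in\mathcal{A}_{\Omega,\omega}\}$, and set, in $[-\infty,\infty]$, $$m^\ast(\omega)=\sup\mathcal{N}_{\Omega,\omega},\qquad m_\ast(\omega)=\inf\mathcal{N}_{\Omega,\omega}\qquad(\sup\emptyset=-\infty,\ \inf\emptyset=\infty).$$ Then: (i) $m_\ast$ and $m^\ast$ are strictly decreasing on $(-\infty,-\lambda_0(\Omega))$;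 (ii) $m_\ast(\omega)\le m^\ast(\omega)$ for every $\omega\in(-\infty,-\lambda_0(\Omega))$; (iii) $m_\ast(\omega_1)>m^\ast(\omega_2)$ whenever $\omega_1<\omega_2<-\lambda_0(\Omega)$. -/

import Mathlib

open MeasureTheory Filter Topology
open scoped ComplexConjugate

noncomputable section

namespace RNLS

/-- Euclidean space `ℝ^d`. -/
abbrev Space (d : ℕ) : Type := EuclideanSpace ℝ (Fin d)

/-- The complex Hilbert space `L²(ℝ^d; ℂ)` with respect to Lebesgue measure. -/
abbrev L2 (d : ℕ) : Type := Lp ℂ 2 (volume : Measure (Space d))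

/-- `g` is the weak (distributional) partial derivative `∂_i f`: for every real test function
`ψ ∈ C_c^∞(ℝ^d)` one has `∫ (∂_i ψ) f = - ∫ ψ g`. -/
def HasWeakPartial {d : ℕ} (i : Fin d) (f g : L2 d) : Prop :=
  ∀ ψ : Space d → ℝ, ContDiff ℝ (⊤ : ℕ∞) ψ → HasCompactSupport ψ →
    ∫ x, (fderiv ℝ ψ x (EuclideanSpace.single i 1)) • f x = - ∫ x, ψ x • g x

/-- A weak partial derivative in `L²` is unique. -/
theorem HasWeakPartial.unique {d : ℕ} {i : Fin d} {f g h : L2 d}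
    (hg : HasWeakPartial i f g) (hh : HasWeakPartial i f h) : g = h := by
  have hgl : LocallyIntegrable g (volume : Measure (Space d)) :=
    (Lp.memLp g).locallyIntegrable (by norm_num)
  have hhl : LocallyIntegrable h (volume : Measure (Space d)) :=
    (Lp.memLp h).locallyIntegrable (by norm_num)
  refine Lp.ext (ae_eq_of_integral_contDiff_smul_eq hgl hhl fun ψ hψ hc => ?_)
  have h1 := hg ψ hψ hc
  rw [hh ψ hψ hc] at h1
  exact (neg_injective h1).symm

open Classical in
/-- The weak partial derivative `∂_i f ∈ L²` (only used when it exists). -/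
def weakPartial {d : ℕ} (i : Fin d) (f : L2 d) : L2 d :=
  if h : ∃ g : L2 d, HasWeakPartial i f g then h.choose else 0

theorem weakPartial_eq {d : ℕ} {i : Fin d} {f g : L2 d} (hg : HasWeakPartial i f g) :
    weakPartial i f = g := by
  have h : ∃ g : L2 d, HasWeakPartial i f g := ⟨g, hg⟩
  rw [weakPartial, dif_pos h]
  exact h.choose_spec.unique hg

/-- The energy space `X = H¹(ℝ^d) ∩ L²_V(ℝ^d)`: all weak partial derivatives exist in `L²`, and
`∫ V |φ|² < ∞`. -/
def energySpace {d : ℕ} (V : Space d → ℝ) : Set (L2 d) :=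
  {φ | (∀ i, ∃ g : L2 d, HasWeakPartial i φ g) ∧ Integrable fun x => V x * ‖φ x‖ ^ 2}

/-- The angular momentum operator: `L_z φ = i (x₂ ∂₁ φ - x₁ ∂₂ φ)` if `d ≥ 2`,
and `L_z φ = 0` if `d = 1`. -/
def angularMomentum {d : ℕ} (φ : L2 d) (x : Space d) : ℂ :=
  if h : 2 ≤ d then
    Complex.I * ((x ⟨1, by omega⟩ : ℂ) * weakPartial ⟨0, by omega⟩ φ x
      - (x ⟨0, by omega⟩ : ℂ) * weakPartial ⟨1, by omega⟩ φ x)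
  else 0

/-- The squared distance to the axis of rotation: `x₁² + x₂²` if `d ≥ 2`, and `0` if `d = 1`
(where there is no rotation). -/
def planarRadiusSq {d : ℕ} (x : Space d) : ℝ :=
  if h : 2 ≤ d then x ⟨0, by omega⟩ ^ 2 + x ⟨1, by omega⟩ ^ 2 else 0

/-- The maximal rotating speed
`Ω_max = sup {γ > 0 : V(x) - γ²/2 (x₁² + x₂²) → ∞ as |x| → ∞} ≤ ∞`. -/
def maxSpeed {d : ℕ} (V : Space d → ℝ) : EReal :=
  sSup ((fun γ : ℝ => (γ : EReal)) '' {γ : ℝ | 0 < γ ∧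
    Tendsto (fun x => V x - γ ^ 2 / 2 * planarRadiusSq x) (cocompact (Space d)) atTop})

/-- The quadratic form of `R = -½Δ + V - Ω L_z`:
`½ ‖∇φ‖² + ∫ V |φ|² - Ω ∫ φ̄ L_z φ`. The last integral is real for `φ` in the energy space,
so that taking its real part only makes the form real-valued in Lean. -/
def linearEnergy {d : ℕ} (V : Space d → ℝ) (Ω : ℝ) (φ : L2 d) : ℝ :=
  1 / 2 * (∑ i, ‖weakPartial i φ‖ ^ 2) + (∫ x, V x * ‖φ x‖ ^ 2)
    - Ω * (∫ x, conj (φ x) * angularMomentum φ x).re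

/-- `λ₀(Ω) = inf_{0 ≠ φ ∈ X} ⟨Rφ, φ⟩ / ‖φ‖²`, as an extended real number (so that it is `∞` in
the degenerate case `X = {0}`). -/
def lambda0 {d : ℕ} (V : Space d → ℝ) (Ω : ℝ) : EReal :=
  sInf ((fun φ : L2 d => ((linearEnergy V Ω φ / ‖φ‖ ^ 2 : ℝ) : EReal)) ''
    {φ | φ ∈ energySpace V ∧ φ ≠ 0})

/-- The energy `E(φ)`. -/
def energy {d : ℕ} (p : ℝ) (V : Space d → ℝ) (β Ω : ℝ) (φ : L2 d) : ℝ :=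
  linearEnergy V Ω φ + 2 * β / (p + 1) * (∫ x, ‖φ x‖ ^ (p + 1))

/-- The action functional `S_{Ω,ω}(φ) = E(φ) + ω ‖φ‖²`. -/
def action {d : ℕ} (p : ℝ) (V : Space d → ℝ) (β Ω ω : ℝ) (φ : L2 d) : ℝ :=
  energy p V β Ω φ + ω * ‖φ‖ ^ 2

/-- `φ ∈ X` is a weak solution of the stationary equation
`-½Δφ + Vφ + β|φ|^{p-1}φ - Ω L_z φ + ωφ = 0`, tested against all `v ∈ X`. -/
def IsStationary {d : ℕ} (p : ℝ) (V : Space d → ℝ) (β Ω ω : ℝ) (φ : L2 d) : Prop :=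
  φ ∈ energySpace V ∧ ∀ v ∈ energySpace V,
    1 / 2 * (∑ i, ∫ x, weakPartial i φ x * conj (weakPartial i v x))
      + (∫ x, (V x : ℂ) * φ x * conj (v x))
      + (β : ℂ) * (∫ x, ((‖φ x‖ ^ (p - 1) : ℝ) : ℂ) * φ x * conj (v x))
      - (Ω : ℂ) * (∫ x, angularMomentum φ x * conj (v x))
      + (ω : ℂ) * (∫ x, φ x * conj (v x)) = 0

/-- The set `𝒜_{Ω,ω}` of action ground states: the minimizers of the action among all nonzero
solutions of the stationary equation. -/
def actionGroundStates {d : ℕ} (p : ℝ) (V : Space d → ℝ) (β Ω ω : ℝ) : Set (L2 d) :=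
  {φ | (φ ≠ 0 ∧ IsStationary p V β Ω ω φ) ∧
    ∀ χ : L2 d, χ ≠ 0 → IsStationary p V β Ω ω χ →
      action p V β Ω ω φ ≤ action p V β Ω ω χ}

/-- The set `𝒩_{Ω,ω}` of the masses `‖φ‖²` of the action ground states. -/
def groundMasses {d : ℕ} (p : ℝ) (V : Space d → ℝ) (β Ω ω : ℝ) : Set ℝ :=
  (fun φ : L2 d => ‖φ‖ ^ 2) '' actionGroundStates p V β Ω ω

/-- `m^*(ω) = sup 𝒩_{Ω,ω}`, an extended real number (`sup ∅ = -∞`). -/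
def upperMass {d : ℕ} (p : ℝ) (V : Space d → ℝ) (β Ω ω : ℝ) : EReal :=
  sSup ((fun m : ℝ => (m : EReal)) '' groundMasses p V β Ω ω)

/-- `m_*(ω) = inf 𝒩_{Ω,ω}`, an extended real number (`inf ∅ = ∞`). -/
def lowerMass {d : ℕ} (p : ℝ) (V : Space d → ℝ) (β Ω ω : ℝ) : EReal :=
  sInf ((fun m : ℝ => (m : EReal)) '' groundMasses p V β Ω ω)

end RNLS

end

/-!
Below `-λ₀(Ω)` the action `S_ω` takes negative values on the energy space `X`, and it attains its
minimum there (`exists_minimizer`). The minimizer is nonzero and stationary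
(`isStationary_of_minimizer`), so the action ground states at `ω` are exactly the minimizers of
`S_ω` on all of `X` (`actionGroundStates_spec`). As `S_ω = E + ω ‖·‖²`, comparing a ground state
`φ₁` at `ω₁` and a ground state `φ₂` at `ω₂ > ω₁` in both functionals gives `‖φ₂‖ ≤ ‖φ₁‖`. Equality
would make `φ₂` a minimizer of `S_{ω₁}` too, hence stationary for two different frequencies, which
forces `φ₂ = 0` (`mass_lt_of_lt`). Inserting two intermediate frequencies turns this strict
inequality between single ground states into the strict inequality between the supremum of the
masses at `ω₂` and their infimum at `ω₁`.

The analytic part is the existence and the stationarity of minimizers.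

* Weak derivatives are identified with multiplication by `2πiξ` on the Fourier side
  (`HasWeakPartial.fourier_ae`). Splitting a function into low and high frequencies then gives both
  compactness in `L²` of sequences with bounded energy (`exists_subseq_tendsto`) and the subcritical
  Sobolev embedding `H¹ ⊂ L^{p+1}` (`integrable_norm_rpow`), the latter by a weak-type estimate
  with the splitting frequency adapted to the level. Without this embedding the nonlinear term could
  be infinite on `X`.
* For `|Ω| < Ω_max` the potential dominates the rotation term (`exists_angularForm_bound`), and
  the angular momentum operator is symmetric on `X` (`angularForm_conj`). So the quadratic part of
  the action is a Hermitian form, bounded below by kinetic and potential energy up to a multiple of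
  the mass; the mass itself is absorbed by the potential at infinity and by the nonlinear term
  elsewhere (`exists_action_lower_bound`).
* A minimizing sequence has an `L²`-convergent subsequence. The only term of the action that is not
  convex is the mass, which converges; the parallelogram identity therefore makes the subsequence
  Cauchy in the energy norm (`action_midpoint_le`), and its limit is a minimizer by Fatou's lemma.
-/

namespace RNLS

/-! ### Smooth cutoffs -/

/-- Dilated bump functions `χ (x / (n + 1))`; the last bound reflects that `‖x‖ ‖∇χ‖` is invariant
under dilations. -/
theorem exists_smooth_cutoff (d : ℕ) : ∃ χ : ℕ → Space d → ℝ,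
    (∀ n, ContDiff ℝ (⊤ : ℕ∞) (χ n)) ∧ (∀ n, HasCompactSupport (χ n)) ∧ (∀ n x, |χ n x| ≤ 1) ∧
    (∀ x, Tendsto (fun n => χ n x) atTop (𝓝 1)) ∧
    ∃ C : ℝ, 0 ≤ C ∧ (∀ n x, ‖fderiv ℝ (χ n) x‖ ≤ C / (n + 1)) ∧
      ∀ n x, ‖x‖ * ‖fderiv ℝ (χ n) x‖ ≤ C := by
  let η : ContDiffBump (0 : Space d) := ⟨1, 2, by norm_num, by norm_num⟩
  have hη : ContDiff ℝ (⊤ : ℕ∞) η := η.contDiff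
  have hηd : Continuous (fderiv ℝ η) := hη.continuous_fderiv (by simp)
  have hsupp : HasCompactSupport (fderiv ℝ η) := η.hasCompactSupport.fderiv (𝕜 := ℝ)
  obtain ⟨C₁, hC₁⟩ := hηd.bounded_above_of_compact_support hsupp
  obtain ⟨C₂, hC₂⟩ := (show Continuous fun x : Space d => ‖x‖ * ‖fderiv ℝ η x‖ from
    by fun_prop).bounded_above_of_compact_support hsupp.norm.mul_left
  let s : ℕ → ℝ := fun n => ((n : ℝ) + 1)⁻¹
  have hs : ∀ n, 0 < s n := fun n => by positivity
  have hfd : ∀ n x, fderiv ℝ (fun x : Space d => η (s n • x)) x = s n • fderiv ℝ η (s n • x) :=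
    fun n x => by
      have := fderiv_comp_smul (𝕜 := ℝ) (f := η) (x := x) (s n)
      simpa using this
  refine ⟨fun n x => η (s n • x), fun n => hη.comp (contDiff_const_smul _),
    fun n => η.hasCompactSupport.comp_smul (hs n).ne', fun n x => ?_, fun x => ?_,
    max C₁ C₂, ?_, fun n x => ?_, fun n x => ?_⟩
  · rw [abs_of_nonneg η.nonneg]; exact η.le_one
  · have h1 : Tendsto (fun n => s n • x) atTop (𝓝 0) := by
      have : Tendsto s atTop (𝓝 0) := by
        simpa [s] using tendsto_one_div_add_atTop_nhds_zero_nat (𝕜 := ℝ)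
      simpa using this.smul_const x
    have h2 := (η.continuous.tendsto 0).comp h1
    have h3 : η (0 : Space d) = 1 := η.one_of_mem_closedBall (by simp [η])
    rw [h3] at h2
    exact h2
  · exact le_max_of_le_left ((norm_nonneg _).trans (hC₁ 0))
  · simp only [hfd, norm_smul, Real.norm_eq_abs, abs_of_pos (hs n)]
    rw [div_eq_mul_inv, mul_comm]
    exact mul_le_mul_of_nonneg_right ((hC₁ _).trans (le_max_left _ _)) (hs n).le
  · simp only [hfd, norm_smul, Real.norm_eq_abs, abs_of_pos (hs n)]
    have := hC₂ (s n • x)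
    simp only [norm_smul, Real.norm_eq_abs, abs_of_pos (hs n), norm_mul, abs_norm] at this
    calc _ = s n * ‖x‖ * ‖fderiv ℝ η (s n • x)‖ := by ring
      _ ≤ _ := this.trans (le_max_right _ _)

/-- The cutoffs of `exists_smooth_cutoff`, with the limits that they produce in integrals. -/
theorem exists_cutoff_tendsto (d : ℕ) : ∃ χ : ℕ → Space d → ℝ,
    (∀ n, ContDiff ℝ (⊤ : ℕ∞) (χ n)) ∧ (∀ n, HasCompactSupport (χ n)) ∧
    (∀ {F : Space d → ℂ}, Integrable F →
      Tendsto (fun n => ∫ x, (χ n x : ℂ) * F x) atTop (𝓝 (∫ x, F x))) ∧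
    (∀ (e : Space d) {F : Space d → ℂ}, Integrable F →
      Tendsto (fun n => ∫ x, (fderiv ℝ (χ n) x e : ℂ) * F x) atTop (𝓝 0)) ∧
    ∀ (e : Space d) (j : Fin d) {F : Space d → ℂ}, Integrable F →
      Tendsto (fun n => ∫ x, ((x j * fderiv ℝ (χ n) x e : ℝ) : ℂ) * F x) atTop (𝓝 0) := by
  obtain ⟨χ, hχs, hχc, hχ1, hχt, C, hC0, hC, hC'⟩ := exists_smooth_cutoff d
  -- all three limits are instances of dominated convergence
  have dom : ∀ (η : ℕ → Space d → ℝ) (c K : ℝ), (∀ n, Continuous (η n)) →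
      (∀ n x, |η n x| ≤ K) → (∀ x, Tendsto (fun n => η n x) atTop (𝓝 c)) →
      ∀ {F : Space d → ℂ}, Integrable F →
        Tendsto (fun n => ∫ x, (η n x : ℂ) * F x) atTop (𝓝 (∫ x, (c : ℂ) * F x)) := by
    intro η c K hη hK hlim F hF
    refine tendsto_integral_of_dominated_convergence (fun x => K * ‖F x‖)
      (fun n => (Complex.continuous_ofReal.comp (hη n)).aestronglyMeasurable.mul hF.1)
      (hF.norm.const_mul K) (fun n => .of_forall fun x => ?_) (.of_forall fun x => ?_)
    · rw [norm_mul, Complex.norm_real]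
      exact mul_le_mul_of_nonneg_right (hK n x) (norm_nonneg _)
    · exact ((Complex.continuous_ofReal.tendsto c).comp (hlim x)).mul_const (F x)
  have hlim0 : ∀ (e x : Space d), Tendsto (fun n => fderiv ℝ (χ n) x e) atTop (𝓝 0) := by
    intro e x
    refine squeeze_zero_norm (a := fun n : ℕ => (C * ‖e‖) * (1 / ((n : ℝ) + 1))) (fun n => ?_) ?_
    · refine ((fderiv ℝ (χ n) x).le_opNorm e).trans
        ((mul_le_mul_of_nonneg_right (hC n x) (norm_nonneg e)).trans (le_of_eq ?_))
      ring
    · simpa using (tendsto_one_div_add_atTop_nhds_zero_nat (𝕜 := ℝ)).const_mul (C * ‖e‖)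
  refine ⟨χ, hχs, hχc, fun hF => ?_, fun e F hF => ?_, fun e j F hF => ?_⟩
  · simpa using dom χ 1 1 (fun n => (hχs n).continuous) hχ1 hχt hF
  · have := dom (fun n x => fderiv ℝ (χ n) x e) 0 (C * ‖e‖)
      (fun n => ((hχs n).continuous_fderiv (by simp)).clm_apply continuous_const)
      (fun n x => ((fderiv ℝ (χ n) x).le_opNorm e).trans (mul_le_mul_of_nonneg_right
        ((hC n x).trans (div_le_self hC0 (by have := n.cast_nonneg (α := ℝ); linarith)))
        (norm_nonneg e))) (hlim0 e) hF
    simpa using this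
  · have := dom (fun n x => x j * fderiv ℝ (χ n) x e) 0 (C * ‖e‖)
      (fun n => Continuous.mul (by fun_prop)
        (((hχs n).continuous_fderiv (by simp)).clm_apply continuous_const))
      (fun n x => ?_) (fun x => by simpa using (hlim0 e x).const_mul (x j)) hF
    · simpa using this
    · have h1 : |x j| ≤ ‖x‖ := by simpa using PiLp.norm_apply_le x j
      rw [abs_mul]
      calc |x j| * |fderiv ℝ (χ n) x e| ≤ ‖x‖ * (‖fderiv ℝ (χ n) x‖ * ‖e‖) := by
            gcongr
            exact (fderiv ℝ (χ n) x).le_opNorm e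
        _ = (‖x‖ * ‖fderiv ℝ (χ n) x‖) * ‖e‖ := by ring
        _ ≤ C * ‖e‖ := by gcongr; exact hC' n x

/-! ### Weak derivatives -/

variable {d : ℕ}

/-- An `L²` function is integrable against a compactly supported continuous function. -/
theorem integrable_smul_of_hasCompactSupport (f : L2 d) {ψ : Space d → ℝ} (hψ : Continuous ψ)
    (hc : HasCompactSupport ψ) : Integrable fun x => ψ x • f x :=
  ((Lp.memLp f).locallyIntegrable (by norm_num)).integrable_smul_left_of_hasCompactSupport hψ hc

theorem continuous_partial {ψ : Space d → ℝ} (hψ : ContDiff ℝ (⊤ : ℕ∞) ψ) (v : Space d) :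
    Continuous fun x => fderiv ℝ ψ x v :=
  (hψ.continuous_fderiv (by simp)).clm_apply continuous_const

theorem hasCompactSupport_partial {ψ : Space d → ℝ} (hc : HasCompactSupport ψ) (v : Space d) :
    HasCompactSupport fun x => fderiv ℝ ψ x v :=
  hc.fderiv_apply (𝕜 := ℝ) v

theorem HasWeakPartial.add {i : Fin d} {f g f' g' : L2 d} (hf : HasWeakPartial i f f')
    (hg : HasWeakPartial i g g') : HasWeakPartial i (f + g) (f' + g') := by
  intro ψ hψ hc
  have h1 : (fun x => (fderiv ℝ ψ x (EuclideanSpace.single i 1)) • (f + g : L2 d) x) =ᵐ[volume]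
      fun x => (fderiv ℝ ψ x (EuclideanSpace.single i 1)) • f x
        + (fderiv ℝ ψ x (EuclideanSpace.single i 1)) • g x := by
    filter_upwards [Lp.coeFn_add f g] with x hx
    rw [hx, Pi.add_apply, smul_add]
  have h2 : (fun x => ψ x • (f' + g' : L2 d) x) =ᵐ[volume] fun x => ψ x • f' x + ψ x • g' x := by
    filter_upwards [Lp.coeFn_add f' g'] with x hx
    rw [hx, Pi.add_apply, smul_add]
  have hd := continuous_partial hψ (EuclideanSpace.single i 1)
  have hdc := hasCompactSupport_partial hc (EuclideanSpace.single i 1)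
  rw [integral_congr_ae h1, integral_congr_ae h2,
    integral_add (integrable_smul_of_hasCompactSupport f hd hdc)
      (integrable_smul_of_hasCompactSupport g hd hdc),
    integral_add (integrable_smul_of_hasCompactSupport f' hψ.continuous hc)
      (integrable_smul_of_hasCompactSupport g' hψ.continuous hc), hf ψ hψ hc, hg ψ hψ hc]
  ring

theorem HasWeakPartial.smul {i : Fin d} {f f' : L2 d} (c : ℂ) (hf : HasWeakPartial i f f') :
    HasWeakPartial i (c • f) (c • f') := by
  intro ψ hψ hc
  have h1 : (fun x => (fderiv ℝ ψ x (EuclideanSpace.single i 1)) • (c • f : L2 d) x) =ᵐ[volume]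
      fun x => c • ((fderiv ℝ ψ x (EuclideanSpace.single i 1)) • f x) := by
    filter_upwards [Lp.coeFn_smul c f] with x hx
    rw [hx, Pi.smul_apply, smul_comm]
  have h2 : (fun x => ψ x • (c • f' : L2 d) x) =ᵐ[volume] fun x => c • (ψ x • f' x) := by
    filter_upwards [Lp.coeFn_smul c f'] with x hx
    rw [hx, Pi.smul_apply, smul_comm]
  rw [integral_congr_ae h1, integral_congr_ae h2, integral_smul, integral_smul, hf ψ hψ hc,
    smul_neg]

/-- The integral of an `L²` function against a test function, as an inner product. -/
theorem exists_inner_eq_integral_smul {ψ : Space d → ℝ} (hψ : Continuous ψ)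
    (hc : HasCompactSupport ψ) :
    ∃ u : L2 d, ∀ f : L2 d, inner ℂ u f = ∫ x, ψ x • f x := by
  have hm : MemLp (fun x => (ψ x : ℂ)) 2 (volume : Measure (Space d)) :=
    (Complex.continuous_ofReal.comp hψ).memLp_of_hasCompactSupport (hc.comp_left rfl)
  refine ⟨hm.toLp _, fun f => ?_⟩
  rw [L2.inner_def]
  refine integral_congr_ae ?_
  filter_upwards [hm.coeFn_toLp] with x hx
  rw [hx]
  simp [RCLike.inner_apply, mul_comm]

/-- The weak derivative is a closed operator. -/
theorem HasWeakPartial.of_tendsto {i : Fin d} {f f' : ℕ → L2 d} {g g' : L2 d}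
    (h : ∀ n, HasWeakPartial i (f n) (f' n)) (hf : Tendsto f atTop (𝓝 g))
    (hf' : Tendsto f' atTop (𝓝 g')) : HasWeakPartial i g g' := by
  intro ψ hψ hc
  obtain ⟨u, hu⟩ := exists_inner_eq_integral_smul
    (continuous_partial hψ (EuclideanSpace.single i 1))
    (hasCompactSupport_partial hc (EuclideanSpace.single i 1))
  obtain ⟨w, hw⟩ := exists_inner_eq_integral_smul hψ.continuous hc
  rw [← hu, ← hw]
  have h1 : Tendsto (fun n => inner ℂ u (f n)) atTop (𝓝 (inner ℂ u g)) :=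
    tendsto_const_nhds.inner hf
  have h2 : Tendsto (fun n => -inner ℂ w (f' n)) atTop (𝓝 (-inner ℂ w g')) :=
    (tendsto_const_nhds.inner hf').neg
  refine tendsto_nhds_unique h1 (h2.congr fun n => ?_)
  rw [hu, hw, h n ψ hψ hc]

/-- Complex-valued test functions may be used in the definition of weak derivatives. -/
theorem HasWeakPartial.integral_complex {i : Fin d} {f g : L2 d} (h : HasWeakPartial i f g)
    {ψ : Space d → ℂ} (hψ : ContDiff ℝ (⊤ : ℕ∞) ψ) (hc : HasCompactSupport ψ) :
    ∫ x, (fderiv ℝ ψ x (EuclideanSpace.single i 1)) * f x = - ∫ x, ψ x * g x := by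
  set e : Space d := EuclideanSpace.single i 1
  have hre : ContDiff ℝ (⊤ : ℕ∞) fun x => (ψ x).re := Complex.reCLM.contDiff.comp hψ
  have him : ContDiff ℝ (⊤ : ℕ∞) fun x => (ψ x).im := Complex.imCLM.contDiff.comp hψ
  have hcre : HasCompactSupport fun x => (ψ x).re := hc.comp_left (g := Complex.re) rfl
  have hcim : HasCompactSupport fun x => (ψ x).im := hc.comp_left (g := Complex.im) rfl
  have hdiff : ∀ x, DifferentiableAt ℝ ψ x := fun x => hψ.differentiable (by simp) x
  have dre : ∀ x, fderiv ℝ (fun x => (ψ x).re) x e = (fderiv ℝ ψ x e).re := fun x => by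
    have := (Complex.reCLM.hasFDerivAt.comp x (hdiff x).hasFDerivAt).fderiv
    exact congrArg (fun L => L e) this
  have dim : ∀ x, fderiv ℝ (fun x => (ψ x).im) x e = (fderiv ℝ ψ x e).im := fun x => by
    have := (Complex.imCLM.hasFDerivAt.comp x (hdiff x).hasFDerivAt).fderiv
    exact congrArg (fun L => L e) this
  have split : ∀ (z w : ℂ), z * w = z.re • w + Complex.I * (z.im • w) := fun z w => by
    conv_lhs => rw [← Complex.re_add_im z]
    simp only [Complex.real_smul]; ring
  have h1 : ∫ x, (fderiv ℝ ψ x e) * f x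
      = (∫ x, (fderiv ℝ (fun x => (ψ x).re) x e) • f x)
        + Complex.I * ∫ x, (fderiv ℝ (fun x => (ψ x).im) x e) • f x := by
    rw [← integral_const_mul, ← integral_add]
    · exact integral_congr_ae (.of_forall fun x => by simp only [dre, dim]; exact split _ _)
    · exact integrable_smul_of_hasCompactSupport f (continuous_partial hre e)
        (hasCompactSupport_partial hcre e)
    · exact (integrable_smul_of_hasCompactSupport f (continuous_partial him e)
        (hasCompactSupport_partial hcim e)).const_mul _
  have h2 : ∫ x, ψ x * g x = (∫ x, (ψ x).re • g x) + Complex.I * ∫ x, (ψ x).im • g x := by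
    rw [← integral_const_mul, ← integral_add]
    · exact integral_congr_ae (.of_forall fun x => split _ _)
    · exact integrable_smul_of_hasCompactSupport g hre.continuous hcre
    · exact (integrable_smul_of_hasCompactSupport g him.continuous hcim).const_mul _
  rw [h1, h2, h _ hre hcre, h _ him hcim]
  ring

open LineDeriv FourierTransform SchwartzMap in
/-- A weak derivative is a derivative in the sense of tempered distributions. The test functions
are cut off. -/
theorem HasWeakPartial.lineDerivOp_toTemperedDistribution {i : Fin d} {f g : L2 d}
    (h : HasWeakPartial i f g) :
    ∂_{(EuclideanSpace.single i (1 : ℝ) : Space d)} (Lp.toTemperedDistribution f)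
      = Lp.toTemperedDistribution g := by
  ext ψ
  rw [TemperedDistribution.lineDerivOp_apply_apply, Lp.toTemperedDistribution_apply,
    Lp.toTemperedDistribution_apply]
  set e : Space d := EuclideanSpace.single i 1 with he
  obtain ⟨χ, hχs, hχc, hχt, hχd, -⟩ := exists_cutoff_tendsto d
  have hψs : ContDiff ℝ (⊤ : ℕ∞) ψ := ψ.smooth _
  have hψd : ∀ x, fderiv ℝ ψ x e = (∂_{e} ψ) x := fun x =>
    (SchwartzMap.lineDerivOp_apply_eq_fderiv e ψ x).symm
  have hfi : ∀ θ : 𝓢(Space d, ℂ), ∀ u : L2 d, Integrable fun x => θ x * u x := fun θ u =>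
    (θ.memLp 2 _).integrable_mul (Lp.memLp u)
  have key : ∀ n, (∫ x, (fderiv ℝ (χ n) x e : ℂ) * (ψ x * f x))
      + (∫ x, (χ n x : ℂ) * ((∂_{e} ψ) x * f x)) = - ∫ x, (χ n x : ℂ) * (ψ x * g x) := by
    intro n
    have hcn : ContDiff ℝ (⊤ : ℕ∞) fun x => (χ n x : ℂ) := Complex.ofRealCLM.contDiff.comp (hχs n)
    have hint := h.integral_complex (ψ := fun x => (χ n x : ℂ) * ψ x) (hcn.mul hψs)
      (HasCompactSupport.mul_right ((hχc n).comp_left (g := ((↑) : ℝ → ℂ)) rfl))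
    have hr : ∀ {η : Space d → ℝ} (θ : 𝓢(Space d, ℂ)), Continuous η → HasCompactSupport η →
        Integrable fun x => (η x : ℂ) * (θ x * f x) := fun {η} θ hη hηc => by
      obtain ⟨C, hC⟩ := hη.bounded_above_of_compact_support hηc
      exact (hfi θ f).bdd_mul (c := C)
        (Complex.continuous_ofReal.comp hη).aestronglyMeasurable
        (.of_forall fun x => by simpa using hC x)
    rw [← integral_add (hr ψ (continuous_partial (hχs n) e) (hasCompactSupport_partial (hχc n) e))
      (hr _ (hχs n).continuous (hχc n))]
    calc _ = ∫ x, (fderiv ℝ (fun x => (χ n x : ℂ) * ψ x) x e) * f x := by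
          refine integral_congr_ae (.of_forall fun x => ?_)
          have hd1 : HasFDerivAt (fun x => (χ n x : ℂ))
              (Complex.ofRealCLM ∘L fderiv ℝ (χ n) x) x :=
            Complex.ofRealCLM.hasFDerivAt.comp x ((hχs n).differentiable (by simp) x).hasFDerivAt
          have hd2 := (hψs.differentiable (by simp) x).hasFDerivAt
          have hd3 : fderiv ℝ (fun x => (χ n x : ℂ) * ψ x) x
              = (χ n x : ℂ) • fderiv ℝ ψ x + ψ x • (Complex.ofRealCLM ∘L fderiv ℝ (χ n) x) :=
            (hd1.mul hd2).fderiv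
          simp only [hd3, ← hψd, add_apply, smul_apply, smul_eq_mul,
            ContinuousLinearMap.comp_apply, Complex.ofRealCLM_apply]
          ring
      _ = _ := by
          rw [hint]
          simp only [mul_assoc]
  have lim := tendsto_nhds_unique
    (((hχd e (hfi ψ f)).add (hχt (hfi (∂_{e} ψ) f))).congr key) (hχt (hfi ψ g)).neg
  simp only [smul_eq_mul, neg_apply, neg_mul, integral_neg]
  rw [zero_add] at lim
  rw [lim, neg_neg]

open LineDeriv FourierTransform SchwartzMap in
/-- On the Fourier side, a weak derivative is multiplication by `2πiξ`. -/
theorem HasWeakPartial.fourier_ae {i : Fin d} {f g : L2 d} (h : HasWeakPartial i f g) :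
    ∀ᵐ ξ, (𝓕 g : L2 d) ξ = (2 * Real.pi * Complex.I) * (ξ i : ℂ) * (𝓕 f : L2 d) ξ := by
  have h1 := congrArg (fun T => 𝓕 T) h.lineDerivOp_toTemperedDistribution
  rw [TemperedDistribution.fourier_lineDerivOp_eq, Lp.fourier_toTemperedDistribution_eq,
    Lp.fourier_toTemperedDistribution_eq] at h1
  have hloc : ∀ u : L2 d, LocallyIntegrable u (volume : Measure (Space d)) := fun u =>
    (Lp.memLp u).locallyIntegrable (by norm_num)
  refine ae_eq_of_integral_contDiff_smul_eq (hloc _)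
    ((hloc _).continuous_mul (g := fun ξ : Space d => (2 * Real.pi * Complex.I) * (ξ i : ℂ))
      (by fun_prop)) fun ψ hψ hc => ?_
  have hc' : HasCompactSupport fun x => (ψ x : ℂ) := hc.comp_left (g := ((↑) : ℝ → ℂ)) rfl
  have hψ' : ContDiff ℝ (⊤ : ℕ∞) fun x => (ψ x : ℂ) := Complex.ofRealCLM.contDiff.comp hψ
  have h2 := congrArg (fun T => T (hc'.toSchwartzMap hψ')) h1
  have htg : (fun x : Space d =>
      ((inner ℝ x (EuclideanSpace.single i (1 : ℝ)) : ℝ) : ℂ)).HasTemperateGrowth := by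
    fun_prop
  simp only [smul_apply, TemperedDistribution.smulLeftCLM_apply_apply,
    Lp.toTemperedDistribution_apply, HasCompactSupport.toSchwartzMap_toFun] at h2
  rw [← integral_smul] at h2
  simp only [SchwartzMap.smulLeftCLM_apply_apply htg, HasCompactSupport.toSchwartzMap_toFun] at h2
  simp only [Complex.real_smul]
  simp only [smul_eq_mul] at h2
  rw [← h2]
  refine integral_congr_ae (.of_forall fun x => ?_)
  simp only [EuclideanSpace.inner_single_right]
  simp
  ring

open FourierTransform in
/-- Integration by parts in `H¹`: weak derivatives are skew-adjoint. -/
theorem HasWeakPartial.inner_eq_neg {i : Fin d} {f f' g g' : L2 d} (hf : HasWeakPartial i f f')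
    (hg : HasWeakPartial i g g') : (inner ℂ f' g : ℂ) = -inner ℂ f g' := by
  rw [← Lp.inner_fourier_eq f' g, ← Lp.inner_fourier_eq f g', L2.inner_def, L2.inner_def,
    ← integral_neg]
  refine integral_congr_ae ?_
  filter_upwards [hf.fourier_ae, hg.fourier_ae] with ξ h1 h2
  rw [h1, h2]
  simp [RCLike.inner_apply, map_ofNat]
  ring

/-! ### Low and high frequencies -/

theorem integrable_norm_sq (f : L2 d) : Integrable fun x => ‖f x‖ ^ 2 :=
  (Lp.memLp f).integrable_norm_pow (by norm_num)

theorem norm_sq_eq_integral (f : L2 d) : ‖f‖ ^ 2 = ∫ x, ‖f x‖ ^ 2 := by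
  have h := inner_self_eq_norm_sq_to_K (𝕜 := ℂ) f
  rw [L2.inner_def] at h
  simp only [inner_self_eq_norm_sq_to_K] at h
  have h2 : ∫ x, ((‖f x‖ : ℂ)) ^ 2 = ((∫ x, ‖f x‖ ^ 2 : ℝ) : ℂ) := by
    rw [← integral_complex_ofReal]
    simp
  have h3 : ((∫ x, ‖f x‖ ^ 2 : ℝ) : ℂ) = (‖f‖ : ℂ) ^ 2 := h2.symm.trans h
  exact_mod_cast h3.symm

/-- Multiplication of an `L²` function by the indicator function of a set. -/
noncomputable def restrictTo {S : Set (Space d)} (hS : MeasurableSet S) (f : L2 d) : L2 d :=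
  ((Lp.memLp f).indicator hS).toLp

theorem coeFn_restrictTo {S : Set (Space d)} (hS : MeasurableSet S) (f : L2 d) :
    restrictTo hS f =ᵐ[volume] S.indicator f :=
  MemLp.coeFn_toLp _

theorem restrictTo_add_restrictTo_compl {S : Set (Space d)} (hS : MeasurableSet S) (f : L2 d) :
    restrictTo hS f + restrictTo hS.compl f = f := by
  refine Lp.ext ?_
  filter_upwards [Lp.coeFn_add (restrictTo hS f) (restrictTo hS.compl f), coeFn_restrictTo hS f,
    coeFn_restrictTo hS.compl f] with x h1 h2 h3
  rw [h1, Pi.add_apply, h2, h3, Set.indicator_self_add_compl_apply]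

theorem norm_restrictTo_sq {S : Set (Space d)} (hS : MeasurableSet S) (f : L2 d) :
    ‖restrictTo hS f‖ ^ 2 = ∫ x in S, ‖f x‖ ^ 2 := by
  rw [norm_sq_eq_integral, ← integral_indicator hS]
  refine integral_congr_ae ?_
  filter_upwards [coeFn_restrictTo hS f] with x hx
  rw [hx]
  by_cases h : x ∈ S <;> simp [h]

theorem norm_restrictTo_le {S : Set (Space d)} (hS : MeasurableSet S) (f : L2 d) :
    ‖restrictTo hS f‖ ≤ ‖f‖ := by
  refine Lp.norm_le_norm_of_ae_le ?_
  filter_upwards [coeFn_restrictTo hS f] with x hx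
  rw [hx]
  exact norm_indicator_le_norm_self _ _

open FourierTransform SchwartzMap in
/-- For functions in `L¹ ∩ L²`, the inverse Fourier transform on `L²` is given by the integral. -/
theorem fourierInv_ae_eq_of_integrable {g : L2 d} (hg : Integrable g) :
    (𝓕⁻ g : L2 d) =ᵐ[volume] 𝓕⁻ (g : Space d → ℂ) := by
  have hcont : Continuous (𝓕⁻ (g : Space d → ℂ)) :=
    VectorFourier.fourierIntegral_continuous Real.continuous_fourierChar
      (L := -innerₗ (Space d)) (by simpa using! continuous_inner.neg) hg
  refine ae_eq_of_integral_contDiff_smul_eq ((Lp.memLp _).locallyIntegrable (by norm_num))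
    hcont.locallyIntegrable fun ψ hψ hc => ?_
  have hc' : HasCompactSupport fun x => (ψ x : ℂ) := hc.comp_left (g := ((↑) : ℝ → ℂ)) rfl
  have hψ' : ContDiff ℝ (⊤ : ℕ∞) fun x => (ψ x : ℂ) := Complex.ofRealCLM.contDiff.comp hψ
  set θ : 𝓢(Space d, ℂ) := hc'.toSchwartzMap hψ'
  have h1 := congrArg (fun T => T θ) (Lp.fourierInv_toTemperedDistribution_eq g)
  simp only [TemperedDistribution.fourierInv_apply, Lp.toTemperedDistribution_apply] at h1
  have h2 := VectorFourier.integral_fourierIntegral_smul_eq_flip (L := -innerₗ (Space d))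
    (μ := volume) (ν := volume)
    Real.continuous_fourierChar (by simpa using! continuous_inner.neg) θ.integrable hg
  have hflip : (-innerₗ (Space d)).flip = -innerₗ (Space d) := by
    ext x y
    simp [real_inner_comm]
  rw [hflip] at h2
  calc ∫ x, ψ x • (𝓕⁻ g : L2 d) x = ∫ x, θ x • (𝓕⁻ g : L2 d) x := by
        refine integral_congr_ae (.of_forall fun x => ?_)
        simp [θ]
    _ = ∫ x, (𝓕⁻ θ) x • g x := h1.symm
    _ = ∫ x, θ x • (𝓕⁻ (g : Space d → ℂ)) x := by
        rw [SchwartzMap.fourierInv_coe]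
        exact h2
    _ = _ := by
        refine integral_congr_ae (.of_forall fun x => ?_)
        simp [θ]

theorem measurableSet_closedBall_zero (M : ℝ) : MeasurableSet (Metric.closedBall (0 : Space d) M) :=
  Metric.isClosed_closedBall.measurableSet

open FourierTransform in
/-- The part of `f` with frequencies `‖ξ‖ ≤ M`. -/
noncomputable def lowPass (M : ℝ) (f : L2 d) : L2 d :=
  𝓕⁻ (restrictTo (measurableSet_closedBall_zero M) (𝓕 f))

open FourierTransform in
/-- The part of `f` with frequencies `‖ξ‖ > M`. -/
noncomputable def highPass (M : ℝ) (f : L2 d) : L2 d :=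
  𝓕⁻ (restrictTo (measurableSet_closedBall_zero M).compl (𝓕 f))

open FourierTransform in
theorem lowPass_add_highPass (M : ℝ) (f : L2 d) : lowPass M f + highPass M f = f := by
  rw [lowPass, highPass, ← FourierTransform.fourierInv_add, restrictTo_add_restrictTo_compl,
    FourierPair.fourierInv_fourier_eq]

open FourierTransform in
theorem norm_fourierInv_L2 (f : L2 d) : ‖(𝓕⁻ f : L2 d)‖ = ‖f‖ :=
  (Lp.fourierTransformₗᵢ (Space d) ℂ).symm.norm_map f

/-- The `H¹` energy `‖f‖² + ∑ ‖g i‖²` of a function `f` with weak partial derivatives `g i`. -/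
noncomputable def sobolevEnergy (f : L2 d) (g : Fin d → L2 d) : ℝ := ‖f‖ ^ 2 + ∑ i, ‖g i‖ ^ 2

open FourierTransform in
/-- Plancherel in `H¹`. As `4π² ≥ 1`, the integral with weight `1 + ‖ξ‖²` is at most the `H¹`
energy. -/
theorem fourier_weight_integrable {f : L2 d} {g : Fin d → L2 d}
    (h : ∀ i, HasWeakPartial i f (g i)) :
    Integrable (fun ξ => (1 + ‖ξ‖ ^ 2) * ‖(𝓕 f : L2 d) ξ‖ ^ 2) ∧
      ∫ ξ, (1 + ‖ξ‖ ^ 2) * ‖(𝓕 f : L2 d) ξ‖ ^ 2 ≤ sobolevEnergy f g := by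
  set F : Space d → ℝ := fun ξ => ‖(𝓕 f : L2 d) ξ‖ ^ 2 + ∑ i, ‖(𝓕 (g i) : L2 d) ξ‖ ^ 2
  have hF : Integrable F :=
    (integrable_norm_sq _).add (integrable_finsetSum _ fun i _ => integrable_norm_sq _)
  have hle : ∀ᵐ ξ, (1 + ‖ξ‖ ^ 2) * ‖(𝓕 f : L2 d) ξ‖ ^ 2 ≤ F ξ := by
    have := ae_all_iff.2 fun i => (h i).fourier_ae
    filter_upwards [this] with ξ hξ
    simp only [F, hξ, norm_mul, mul_pow]
    rw [← Finset.sum_mul, ← Finset.mul_sum]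
    have h1 : ∑ i, ‖((ξ i : ℝ) : ℂ)‖ ^ 2 = ‖ξ‖ ^ 2 := by
      rw [EuclideanSpace.norm_sq_eq]
      simp
    rw [h1]
    have h2 : (1 : ℝ) ≤ ‖(2 : ℂ)‖ ^ 2 * ‖(Real.pi : ℂ)‖ ^ 2 * ‖Complex.I‖ ^ 2 := by
      have := Real.pi_gt_three
      simp only [Complex.norm_real, Complex.norm_I, Real.norm_eq_abs, abs_of_pos Real.pi_pos]
      norm_num
      nlinarith
    have h3 : 0 ≤ ‖ξ‖ ^ 2 * ‖(𝓕 f : L2 d) ξ‖ ^ 2 := by positivity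
    nlinarith
  have hint : Integrable (fun ξ => (1 + ‖ξ‖ ^ 2) * ‖(𝓕 f : L2 d) ξ‖ ^ 2) := by
    refine hF.mono' (Continuous.aestronglyMeasurable (by fun_prop) |>.mul
      (integrable_norm_sq _).1) ?_
    filter_upwards [hle] with ξ hξ
    rwa [Real.norm_of_nonneg (by positivity)]
  refine ⟨hint, (integral_mono_ae hint hF hle).trans (le_of_eq ?_)⟩
  simp only [F]
  rw [integral_add (integrable_norm_sq _) (integrable_finsetSum _ fun i _ => integrable_norm_sq _),
    integral_finsetSum _ fun i _ => integrable_norm_sq _]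
  simp only [← norm_sq_eq_integral, Lp.norm_fourier_eq, sobolevEnergy]

open FourierTransform in
/-- High frequencies of an `H¹` function are small in `L²`. -/
theorem norm_highPass_sq_le {f : L2 d} {g : Fin d → L2 d} (h : ∀ i, HasWeakPartial i f (g i))
    {M : ℝ} (hM : 0 ≤ M) : ‖highPass M f‖ ^ 2 ≤ sobolevEnergy f g / (1 + M ^ 2) := by
  obtain ⟨hint, hle⟩ := fourier_weight_integrable h
  rw [highPass, norm_fourierInv_L2, norm_restrictTo_sq, le_div_iff₀ (by positivity), mul_comm,
    ← integral_const_mul]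
  refine le_trans ?_ hle
  refine le_trans (setIntegral_mono_on ((integrable_norm_sq _).const_mul _).integrableOn
    hint.integrableOn (measurableSet_closedBall_zero M).compl fun ξ hξ => ?_)
    (setIntegral_le_integral hint (.of_forall fun ξ => by positivity))
  have h1 : M ≤ ‖ξ‖ := by
    have : M < ‖ξ‖ := by simpa using hξ
    exact this.le
  gcongr

theorem integrable_restrictTo_ball (M : ℝ) (f : L2 d) :
    Integrable (restrictTo (measurableSet_closedBall_zero M) f) := by
  refine Integrable.congr ?_ (coeFn_restrictTo (measurableSet_closedBall_zero M) f).symm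
  rw [integrable_indicator_iff (measurableSet_closedBall_zero M)]
  exact ((Lp.memLp f).locallyIntegrable (by norm_num)).integrableOn_isCompact
    (isCompact_closedBall 0 M)

open FourierTransform in
theorem lowPass_ae (M : ℝ) (f : L2 d) : ∀ᵐ x, lowPass M f x =
    ∫ ξ in Metric.closedBall 0 M, (Real.fourierChar (inner ℝ ξ x) : ℂ) * (𝓕 f : L2 d) ξ := by
  filter_upwards [fourierInv_ae_eq_of_integrable (integrable_restrictTo_ball M (𝓕 f))] with x hx
  rw [lowPass, hx, Real.fourierInv_eq, ← integral_indicator (measurableSet_closedBall_zero M)]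
  refine integral_congr_ae ?_
  filter_upwards [coeFn_restrictTo (measurableSet_closedBall_zero M) (𝓕 f)] with ξ hξ
  rw [hξ]
  by_cases h : ξ ∈ Metric.closedBall (0 : Space d) M
  · rw [Set.indicator_of_mem h, Set.indicator_of_mem h, Circle.smul_def, smul_eq_mul]
  · rw [Set.indicator_of_notMem h, Set.indicator_of_notMem h, smul_zero]

/-! ### The Sobolev embedding -/

open FourierTransform in
/-- If `d < 2 (1 + a)`, low frequencies of an `H¹` function are bounded by a multiple of
`(1 + M²) ^ (a / 2)`. -/
theorem exists_lowPass_bound {f : L2 d} {g : Fin d → L2 d} (h : ∀ i, HasWeakPartial i f (g i))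
    {a : ℝ} (ha : 0 < a) (had : (d : ℝ) < 2 * (1 + a)) :
    ∃ K : ℝ, 0 < K ∧ ∀ M : ℝ, ∀ᵐ x, ‖lowPass M f x‖ ≤ K * (1 + M ^ 2) ^ (a / 2) := by
  obtain ⟨hint, -⟩ := fourier_weight_integrable h
  set N : ℝ := ∫ ξ, (1 + ‖ξ‖ ^ 2) * ‖(𝓕 f : L2 d) ξ‖ ^ 2
  have hJ : Integrable fun ξ : Space d => (1 + ‖ξ‖ ^ 2) ^ (-(2 * (1 + a)) / 2) :=
    integrable_rpow_neg_one_add_norm_sq (by simpa using had)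
  set J : ℝ := ∫ ξ : Space d, (1 + ‖ξ‖ ^ 2) ^ (-(2 * (1 + a)) / 2)
  have hN0 : 0 ≤ N := integral_nonneg fun ξ => by positivity
  have hJ0 : 0 ≤ J := integral_nonneg fun ξ => by positivity
  refine ⟨(N + J) / 2 + 1, by positivity, fun M => ?_⟩
  filter_upwards [lowPass_ae M f] with x hx
  set s : ℝ := (1 + M ^ 2) ^ (a / 2) with hs
  have hs0 : 0 < s := by positivity
  have hs2 : s * s = (1 + M ^ 2) ^ a := by
    rw [hs, ← Real.rpow_add (by positivity)]; ring_nf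
  -- weighted AM-GM: `|f̂| ≤ (s w |f̂|² + s⁻¹ w⁻¹) / 2` with `w = 1 + ‖ξ‖²`
  have hpt : ∀ ξ ∈ Metric.closedBall (0 : Space d) M, ‖(𝓕 f : L2 d) ξ‖ ≤
      s / 2 * ((1 + ‖ξ‖ ^ 2) * ‖(𝓕 f : L2 d) ξ‖ ^ 2)
        + s / 2 * (1 + ‖ξ‖ ^ 2) ^ (-(2 * (1 + a)) / 2) := by
    intro ξ hξ
    have hξ' : ‖ξ‖ ≤ M := by simpa using hξ
    set w : ℝ := 1 + ‖ξ‖ ^ 2 with hw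
    have hw0 : 0 < w := by positivity
    set y : ℝ := ‖(𝓕 f : L2 d) ξ‖
    have h1 : w ^ a ≤ s * s := by
      rw [hs2]
      gcongr
      rw [hw]; gcongr
    have h2 : w ^ (-(2 * (1 + a)) / 2) * (w * w ^ a) = 1 := by
      rw [← Real.rpow_one_add' hw0.le (by positivity), ← Real.rpow_add hw0]
      ring_nf
      simp
    set v : ℝ := w ^ (-(2 * (1 + a)) / 2)
    have hv0 : 0 < v := by positivity
    have h3 : 1 ≤ v * (w * (s * s)) := by
      rw [← h2]; gcongr
    have h4 : 1 / (s * w) ≤ s * v := by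
      rw [div_le_iff₀ (by positivity)]; linarith
    have h5 : 2 * y ≤ s * w * y ^ 2 + 1 / (s * w) := by
      have : s * w * y ^ 2 + 1 / (s * w) - 2 * y = (s * w * y - 1) ^ 2 / (s * w) := by
        field_simp; ring
      have : 0 ≤ (s * w * y - 1) ^ 2 / (s * w) := by positivity
      linarith
    nlinarith
  rw [hx]
  have hR : Integrable fun ξ : Space d => s / 2 * ((1 + ‖ξ‖ ^ 2) * ‖(𝓕 f : L2 d) ξ‖ ^ 2)
        + s / 2 * (1 + ‖ξ‖ ^ 2) ^ (-(2 * (1 + a)) / 2) :=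
    (hint.const_mul _).add (hJ.const_mul _)
  calc _ ≤ ∫ ξ in Metric.closedBall 0 M, ‖(𝓕 f : L2 d) ξ‖ := by
        refine (norm_integral_le_integral_norm _).trans (le_of_eq ?_)
        simp only [norm_mul, Circle.norm_coe, one_mul]
    _ ≤ ∫ ξ in Metric.closedBall 0 M, (s / 2 * ((1 + ‖ξ‖ ^ 2) * ‖(𝓕 f : L2 d) ξ‖ ^ 2)
        + s / 2 * (1 + ‖ξ‖ ^ 2) ^ (-(2 * (1 + a)) / 2)) :=
      setIntegral_mono_on (((Lp.memLp _).locallyIntegrable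
        (by norm_num)).integrableOn_isCompact (isCompact_closedBall 0 M)).norm
        hR.integrableOn (measurableSet_closedBall_zero M) hpt
    _ ≤ ∫ ξ, (s / 2 * ((1 + ‖ξ‖ ^ 2) * ‖(𝓕 f : L2 d) ξ‖ ^ 2)
        + s / 2 * (1 + ‖ξ‖ ^ 2) ^ (-(2 * (1 + a)) / 2)) :=
      setIntegral_le_integral hR (.of_forall fun ξ => by positivity)
    _ = s / 2 * N + s / 2 * J := by
      rw [integral_add (hint.const_mul _) (hJ.const_mul _), integral_const_mul, integral_const_mul]
    _ ≤ ((N + J) / 2 + 1) * s := by nlinarith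

/-- Chebyshev's inequality in `L²`. -/
theorem volume_lt_norm_le (f : L2 d) {t : ℝ} (ht : 0 < t) :
    volume {x | t ≤ ‖f x‖} ≤ ENNReal.ofReal (‖f‖ ^ 2 / t ^ 2) := by
  have h1 := mul_meas_ge_le_integral_of_nonneg (μ := (volume : Measure (Space d)))
    (.of_forall fun x => sq_nonneg ‖f x‖) (integrable_norm_sq f) (t ^ 2)
  have h2 : {x | t ^ 2 ≤ ‖f x‖ ^ 2} = {x | t ≤ ‖f x‖} := by
    ext x
    exact pow_le_pow_iff_left₀ ht.le (norm_nonneg _) (by norm_num)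
  rw [h2, ← norm_sq_eq_integral] at h1
  have hfin : volume {x | t ≤ ‖f x‖} ≠ ⊤ := by
    rw [← h2]
    exact ((integrable_norm_sq f).measure_ge_lt_top (by positivity)).ne
  rw [← ENNReal.ofReal_toReal hfin]
  refine ENNReal.ofReal_le_ofReal ?_
  rw [le_div_iff₀ (by positivity), mul_comm]
  exact h1

/-- A weak-type estimate for `H¹` functions: split `f` at the frequency for which the low part is
bounded by half of the level. -/
theorem exists_volume_lt_norm_le {f : L2 d} {g : Fin d → L2 d}
    (h : ∀ i, HasWeakPartial i f (g i)) {a : ℝ} (ha : 0 < a) (had : (d : ℝ) < 2 * (1 + a)) :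
    ∃ T C : ℝ, 0 < T ∧ 0 ≤ C ∧ ∀ t, T < t →
      volume {x | t < ‖f x‖} ≤ ENNReal.ofReal (C * t ^ (-2 - 2 / a)) := by
  obtain ⟨K, hK, hlow⟩ := exists_lowPass_bound h ha had
  set N := sobolevEnergy f g
  have hN : 0 ≤ N := by simp only [N, sobolevEnergy]; positivity
  refine ⟨2 * K, 4 * N * (2 * K) ^ (2 / a), by positivity, by positivity, fun t ht => ?_⟩
  have ht0 : 0 < t := lt_trans (by positivity) ht
  have hr : 1 ≤ t / (2 * K) := by rw [le_div_iff₀ (by positivity)]; linarith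
  set r := t / (2 * K) with hrdef
  have hr0 : 0 < r := by linarith
  have hr1 : 1 ≤ r ^ (2 / a) := Real.one_le_rpow hr (by positivity)
  set M := Real.sqrt (r ^ (2 / a) - 1) with hM
  have hM2 : 1 + M ^ 2 = r ^ (2 / a) := by
    rw [hM, Real.sq_sqrt (by linarith)]; ring
  have hlev : K * (1 + M ^ 2) ^ (a / 2) = t / 2 := by
    rw [hM2, ← Real.rpow_mul hr0.le]
    have : 2 / a * (a / 2) = 1 := by field_simp
    rw [this, Real.rpow_one, hrdef]
    field_simp
  have hsub : volume {x | t < ‖f x‖} ≤ volume {x | t / 2 ≤ ‖highPass M f x‖} := by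
    refine measure_mono_ae ?_
    have hadd := Lp.coeFn_add (lowPass M f) (highPass M f)
    rw [lowPass_add_highPass] at hadd
    filter_upwards [hlow M, hadd] with x h1 h2 h3
    have h3' : t < ‖f x‖ := h3
    rw [h2, Pi.add_apply] at h3'
    rw [hlev] at h1
    have := norm_add_le (lowPass M f x) (highPass M f x)
    change t / 2 ≤ ‖highPass M f x‖
    linarith
  refine (hsub.trans (volume_lt_norm_le _ (by positivity))).trans (ENNReal.ofReal_le_ofReal ?_)
  have h1 := norm_highPass_sq_le h (Real.sqrt_nonneg (r ^ (2 / a) - 1))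
  rw [← hM, hM2] at h1
  rw [div_le_iff₀ (by positivity)]
  refine h1.trans (le_of_eq ?_)
  have e1 : t ^ (-2 - 2 / a) = (t ^ 2)⁻¹ * (t ^ (2 / a))⁻¹ := by
    rw [sub_eq_add_neg, Real.rpow_add ht0, Real.rpow_neg ht0.le, Real.rpow_neg ht0.le]
    norm_num
  have e2 : r ^ (2 / a) = t ^ (2 / a) / (2 * K) ^ (2 / a) := by
    rw [hrdef, Real.div_rpow ht0.le (by positivity)]
  rw [e1, e2]
  have e3 : (t ^ (2 / a)) ≠ 0 := by positivity
  have e4 : ((2 * K) ^ (2 / a)) ≠ 0 := by positivity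
  field_simp
  ring

/-- The exponent in the weak-type estimate can be chosen above `p + 1` if `p` is subcritical. -/
theorem exists_sobolev_exponent {p : ℝ} (hp : 1 < p)
    (hpd : 3 ≤ d → p < ((d : ℝ) + 2) / ((d : ℝ) - 2)) :
    ∃ a : ℝ, 0 < a ∧ (d : ℝ) < 2 * (1 + a) ∧ p + 1 < 2 + 2 / a := by
  have hp1 : 0 < p - 1 := by linarith
  rcases le_or_gt 3 d with hd | hd
  · have hd' : (3 : ℝ) ≤ d := by exact_mod_cast hd
    have h1 := hpd hd
    rw [lt_div_iff₀ (by linarith)] at h1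
    have h2 : ((d : ℝ) - 2) / 2 < 2 / (p - 1) := by
      rw [div_lt_div_iff₀ (by norm_num) hp1]; nlinarith
    obtain ⟨a, ha1, ha2⟩ := exists_between h2
    have ha0 : 0 < a := lt_trans (by linarith) ha1
    refine ⟨a, ha0, by linarith, ?_⟩
    rw [lt_div_iff₀ hp1] at ha2
    have : p - 1 < 2 / a := by rw [lt_div_iff₀ ha0]; linarith
    linarith
  · have hd' : (d : ℝ) ≤ 2 := by exact_mod_cast Nat.lt_succ_iff.mp hd
    refine ⟨1 / (p - 1), by positivity, ?_, ?_⟩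
    · have : 0 < 1 / (p - 1) := by positivity
      linarith
    · rw [div_div_eq_mul_div]
      linarith

/-- The Sobolev embedding `H¹ ⊂ L^{p+1}` for subcritical `p`. -/
theorem integrable_norm_rpow {f : L2 d} {g : Fin d → L2 d} (h : ∀ i, HasWeakPartial i f (g i))
    {p : ℝ} (hp : 1 < p) (hpd : 3 ≤ d → p < ((d : ℝ) + 2) / ((d : ℝ) - 2)) :
    Integrable fun x => ‖f x‖ ^ (p + 1) := by
  obtain ⟨a, ha, had, hpa⟩ := exists_sobolev_exponent hp hpd
  obtain ⟨T, C, hT, hC, hvol⟩ := exists_volume_lt_norm_le h ha had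
  have hm : AEMeasurable (fun x => ‖f x‖) (volume : Measure (Space d)) :=
    (Lp.aestronglyMeasurable f).norm.aemeasurable
  refine ⟨(hm.pow_const _).aestronglyMeasurable, ?_⟩
  rw [hasFiniteIntegral_iff_ofReal (.of_forall fun x => by positivity),
    lintegral_rpow_eq_lintegral_meas_lt_mul _ (.of_forall fun x => norm_nonneg _) hm
      (by linarith : 0 < p + 1)]
  refine ENNReal.mul_lt_top ENNReal.ofReal_lt_top ?_
  rw [← Set.Ioc_union_Ioi_eq_Ioi hT.le]
  refine (lintegral_union_le _ _ _).trans_lt (ENNReal.add_lt_top.2 ⟨?_, ?_⟩)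
  · -- small levels: Chebyshev in `L²`, with `t ^ (p - 2)` integrable at `0`
    have hi : IntegrableOn (fun t : ℝ => ‖f‖ ^ 2 * t ^ (p - 2)) (Set.Ioc 0 T) :=
      ((intervalIntegrable_iff_integrableOn_Ioc_of_le hT.le).1
        (intervalIntegral.intervalIntegrable_rpow' (by linarith))).const_mul _
    refine (setLIntegral_mono' measurableSet_Ioc fun t ht => ?_).trans_lt hi.lintegral_lt_top
    have ht0 : 0 < t := ht.1
    have h1 : volume {x | t < ‖f x‖} ≤ ENNReal.ofReal (‖f‖ ^ 2 / t ^ 2) :=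
      (measure_mono fun x (hx : t < ‖f x‖) => hx.le).trans (volume_lt_norm_le f ht0)
    refine (mul_le_mul_left h1 _).trans (le_of_eq ?_)
    rw [← ENNReal.ofReal_mul (by positivity)]
    congr 1
    have : t ^ (p - 2) = t ^ (p + 1 - 1) / t ^ 2 := by
      rw [← Real.rpow_natCast t 2, ← Real.rpow_sub ht0]
      congr 1
      push_cast
      ring
    rw [this]
    ring
  · have hi : IntegrableOn (fun t : ℝ => C * t ^ (p - 2 - 2 / a)) (Set.Ioi T) :=
      (integrableOn_Ioi_rpow_of_lt (by linarith) hT).const_mul _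
    refine (setLIntegral_mono' measurableSet_Ioi fun t ht => ?_).trans_lt hi.lintegral_lt_top
    have ht0 : 0 < t := hT.trans ht
    refine (mul_le_mul_left (hvol t ht) _).trans (le_of_eq ?_)
    rw [← ENNReal.ofReal_mul (by positivity)]
    congr 1
    rw [mul_assoc, ← Real.rpow_add ht0]
    congr 2
    ring

/-! ### Compactness -/

/-- Bounded sequences in `L²` have weakly convergent subsequences. -/
theorem exists_subseq_weakly_tendsto {f : ℕ → L2 d} {B : ℝ} (hB : ∀ n, ‖f n‖ ≤ B) :
    ∃ (θ : ℕ → ℕ) (u : L2 d), StrictMono θ ∧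
      ∀ w : L2 d, Tendsto (fun n => (inner ℂ w (f (θ n)) : ℂ)) atTop (𝓝 (inner ℂ w u)) := by
  have : Fact ((2 : ENNReal) ≠ ⊤) := ⟨by norm_num⟩
  have : SecondCountableTopology (L2 d) := Lp.SecondCountableTopology
  let F : ℕ → WeakDual ℂ (L2 d) := fun n =>
    StrongDual.toWeakDual (InnerProductSpace.toDual ℂ (L2 d) (f n))
  obtain ⟨ℓ, -, θ, hθ, hlim⟩ := WeakDual.isSeqCompact_closedBall ℂ (L2 d) 0 B
    (x := F) (fun n => by simpa [F] using hB n)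
  refine ⟨θ, (InnerProductSpace.toDual ℂ (L2 d)).symm (WeakDual.toStrongDual ℓ), hθ, fun w => ?_⟩
  have h1 := ((WeakDual.eval_continuous w).tendsto ℓ).comp hlim
  have h2 := (Complex.continuous_conj.tendsto _).comp h1
  have e1 : ∀ n, conj (F (θ n) w) = inner ℂ w (f (θ n)) := fun n => by
    change conj (inner ℂ (f (θ n)) w) = _
    exact inner_conj_symm _ _
  have e2 : conj (ℓ w) =
      inner ℂ w ((InnerProductSpace.toDual ℂ (L2 d)).symm (WeakDual.toStrongDual ℓ)) := by
    rw [← inner_conj_symm w, InnerProductSpace.toDual_symm_apply]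
    rfl
  rw [← e2]
  exact h2.congr e1

/-- The truncated Fourier integral is a continuous linear functional on `L²`. -/
theorem exists_inner_eq_truncated_fourier (M : ℝ) (x : Space d) : ∃ k : L2 d, ∀ u : L2 d,
    ∫ ξ in Metric.closedBall 0 M, (Real.fourierChar (inner ℝ ξ x) : ℂ) * u ξ = inner ℂ k u := by
  have hc : Continuous fun ξ : Space d => conj (Real.fourierChar (inner ℝ ξ x) : ℂ) := by
    have := Real.continuous_fourierChar
    fun_prop
  have : IsFiniteMeasure ((volume : Measure (Space d)).restrict (Metric.closedBall 0 M)) :=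
    ⟨by simpa using measure_closedBall_lt_top⟩
  have hm : MemLp ((Metric.closedBall 0 M).indicator
      fun ξ : Space d => conj (Real.fourierChar (inner ℝ ξ x) : ℂ)) 2 volume := by
    rw [memLp_indicator_iff_restrict (measurableSet_closedBall_zero M)]
    exact MemLp.of_bound hc.aestronglyMeasurable 1 (.of_forall fun ξ => by
      rw [RCLike.norm_conj, Circle.norm_coe])
  refine ⟨hm.toLp _, fun u => ?_⟩
  rw [L2.inner_def, ← integral_indicator (measurableSet_closedBall_zero M)]
  refine integral_congr_ae ?_
  filter_upwards [hm.coeFn_toLp] with ξ hξ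
  rw [hξ]
  by_cases h : ξ ∈ Metric.closedBall (0 : Space d) M
  · rw [Set.indicator_of_mem h, Set.indicator_of_mem h]
    simp [RCLike.inner_apply, mul_comm]
  · rw [Set.indicator_of_notMem h, Set.indicator_of_notMem h]
    simp

/-- On a bounded set, the low frequencies of a weakly convergent sequence converge strongly. -/
theorem tendsto_restrictTo_lowPass {f : ℕ → L2 d} {u : L2 d} {B : ℝ} (hB : ∀ n, ‖f n‖ ≤ B)
    (hw : ∀ w : L2 d, Tendsto (fun n => (inner ℂ w (f n) : ℂ)) atTop (𝓝 (inner ℂ w u))) (R M : ℝ) :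
    Tendsto (fun n => restrictTo (measurableSet_closedBall_zero R) (lowPass M (f n))) atTop
      (𝓝 (restrictTo (measurableSet_closedBall_zero R) (lowPass M u))) := by
  set S : Set (Space d) := Metric.closedBall 0 R
  have hS : MeasurableSet S := measurableSet_closedBall_zero R
  set A : ℝ := volume.real (Metric.closedBall (0 : Space d) M)
  -- a uniform bound for low frequencies, by `y ≤ y² + 1`
  have hbound : ∀ v : L2 d, ∀ᵐ x, ‖lowPass M v x‖ ≤ ‖v‖ ^ 2 + A := by
    intro v
    filter_upwards [lowPass_ae M v] with x hx
    rw [hx]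
    have hfin : volume (Metric.closedBall (0 : Space d) M) < ⊤ := measure_closedBall_lt_top
    have hi : IntegrableOn (fun _ : Space d => (1 : ℝ)) (Metric.closedBall 0 M) :=
      integrableOn_const hfin.ne
    calc _ ≤ ∫ ξ in Metric.closedBall 0 M, ‖(FourierTransform.fourier v : L2 d) ξ‖ := by
          refine (norm_integral_le_integral_norm _).trans (le_of_eq ?_)
          simp only [norm_mul, Circle.norm_coe, one_mul]
      _ ≤ ∫ ξ in Metric.closedBall 0 M, (‖(FourierTransform.fourier v : L2 d) ξ‖ ^ 2 + 1) := by
          refine integral_mono_of_nonneg (.of_forall fun ξ => norm_nonneg _)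
            ((integrable_norm_sq _).integrableOn.add hi) (.of_forall fun ξ => ?_)
          nlinarith [sq_nonneg (‖(FourierTransform.fourier v : L2 d) ξ‖ - 1)]
      _ ≤ ‖v‖ ^ 2 + A := by
          rw [integral_add (integrable_norm_sq _).integrableOn hi]
          refine add_le_add ?_ (by simp [A])
          rw [← Lp.norm_fourier_eq v, norm_sq_eq_integral]
          exact setIntegral_le_integral (integrable_norm_sq _) (.of_forall fun ξ => by positivity)
  have hpt : ∀ᵐ x, Tendsto (fun n => lowPass M (f n) x) atTop (𝓝 (lowPass M u x)) := by
    have h1 := ae_all_iff.2 fun n => lowPass_ae M (f n)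
    filter_upwards [h1, lowPass_ae M u] with x hx hu
    obtain ⟨k, hk⟩ := exists_inner_eq_truncated_fourier M x
    simp only [hx, hu, hk]
    have e : ∀ v : L2 d, (inner ℂ k (FourierTransform.fourier v) : ℂ)
        = inner ℂ (FourierTransformInv.fourierInv k) v := fun v => by
      rw [← Lp.inner_fourier_eq (FourierTransformInv.fourierInv k) v,
        FourierInvPair.fourier_fourierInv_eq]
    simp only [e]
    exact hw _
  have hfin : volume S < ⊤ := measure_closedBall_lt_top
  have hint : Tendsto (fun n => ∫ x in S, ‖lowPass M (f n) x - lowPass M u x‖ ^ 2) atTop (𝓝 0) := by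
    have h0 : (0 : ℝ) = ∫ x in S, (0 : ℝ) := by simp
    rw [h0]
    refine tendsto_integral_of_dominated_convergence
      (fun _ => ((B ^ 2 + A) + (‖u‖ ^ 2 + A)) ^ 2) (fun n => ?_) (integrableOn_const hfin.ne)
      (fun n => ae_restrict_of_ae ?_) (ae_restrict_of_ae ?_)
    · exact (((Lp.aestronglyMeasurable _).sub (Lp.aestronglyMeasurable _)).norm.pow 2).restrict
    · filter_upwards [hbound (f n), hbound u] with x h1 h2
      rw [Real.norm_of_nonneg (by positivity)]
      have : ‖f n‖ ^ 2 ≤ B ^ 2 := pow_le_pow_left₀ (norm_nonneg _) (hB n) 2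
      gcongr
      exact (norm_sub_le _ _).trans (by linarith)
    · filter_upwards [hpt] with x hx
      have := ((hx.sub_const (lowPass M u x)).norm).pow 2
      simpa using this
  rw [tendsto_iff_norm_sub_tendsto_zero]
  have hsq : Tendsto (fun n => ‖restrictTo hS (lowPass M (f n)) - restrictTo hS (lowPass M u)‖ ^ 2)
      atTop (𝓝 0) := by
    refine hint.congr fun n => ?_
    rw [norm_sq_eq_integral, ← integral_indicator hS]
    refine integral_congr_ae ?_
    filter_upwards [Lp.coeFn_sub (restrictTo hS (lowPass M (f n))) (restrictTo hS (lowPass M u)),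
      coeFn_restrictTo hS (lowPass M (f n)), coeFn_restrictTo hS (lowPass M u)] with x h1 h2 h3
    rw [h1, Pi.sub_apply, h2, h3]
    by_cases h : x ∈ S <;> simp [h]
  have := hsq.sqrt
  simpa using this

theorem restrictTo_add {S : Set (Space d)} (hS : MeasurableSet S) (f g : L2 d) :
    restrictTo hS (f + g) = restrictTo hS f + restrictTo hS g := by
  refine Lp.ext ?_
  filter_upwards [coeFn_restrictTo hS (f + g), coeFn_restrictTo hS f, coeFn_restrictTo hS g,
    Lp.coeFn_add f g, Lp.coeFn_add (restrictTo hS f) (restrictTo hS g)] with x h1 h2 h3 h4 h5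
  rw [h1, h5, Pi.add_apply, h2, h3]
  by_cases h : x ∈ S
  · simp only [Set.indicator_of_mem h, h4, Pi.add_apply]
  · simp only [Set.indicator_of_notMem h, add_zero]

/-- Rellich compactness: a sequence which is bounded in `H¹` and uniformly small at infinity
has a subsequence that converges in `L²`. -/
theorem exists_subseq_tendsto {f : ℕ → L2 d} {g : ℕ → Fin d → L2 d}
    (h : ∀ n i, HasWeakPartial i (f n) (g n i)) {B : ℝ}
    (hB : ∀ n, sobolevEnergy (f n) (g n) ≤ B)
    (htail : ∀ ε > 0, ∃ R, ∀ n, ‖restrictTo (measurableSet_closedBall_zero R).compl (f n)‖ ≤ ε) :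
    ∃ (θ : ℕ → ℕ) (u : L2 d), StrictMono θ ∧ Tendsto (f ∘ θ) atTop (𝓝 u) := by
  have hnorm : ∀ n, ‖f n‖ ≤ Real.sqrt B := fun n => by
    refine Real.le_sqrt_of_sq_le ((le_trans ?_ (hB n)))
    rw [sobolevEnergy]
    have : 0 ≤ ∑ i, ‖g n i‖ ^ 2 := by positivity
    linarith
  have hB0 : 0 ≤ B := le_trans (by rw [sobolevEnergy]; positivity) (hB 0)
  obtain ⟨θ, u, hθ, hw⟩ := exists_subseq_weakly_tendsto hnorm
  refine ⟨θ, ?_⟩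
  have hcauchy : CauchySeq (f ∘ θ) := by
    refine Metric.cauchySeq_iff.2 fun ε hε => ?_
    obtain ⟨R, hR⟩ := htail (ε / 6) (by positivity)
    obtain ⟨M, hM0, hM⟩ : ∃ M : ℝ, 0 ≤ M ∧ B / (1 + M ^ 2) ≤ (ε / 6) ^ 2 := by
      refine ⟨Real.sqrt (B / (ε / 6) ^ 2), Real.sqrt_nonneg _, ?_⟩
      rw [Real.sq_sqrt (by positivity), div_le_iff₀ (by positivity)]
      have : (ε / 6) ^ 2 * (1 + B / (ε / 6) ^ 2) = (ε / 6) ^ 2 + B := by field_simp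
      rw [this]
      nlinarith [sq_nonneg (ε / 6)]
    set k : ℕ → L2 d := fun n => restrictTo (measurableSet_closedBall_zero R) (lowPass M (f (θ n)))
    have hk : CauchySeq k :=
      (tendsto_restrictTo_lowPass (fun n => hnorm (θ n)) hw R M).cauchySeq
    have hclose : ∀ n, ‖f (θ n) - k n‖ ≤ ε / 3 := by
      intro n
      have hhigh : ‖highPass M (f (θ n))‖ ≤ ε / 6 := by
        refine (pow_le_pow_iff_left₀ (norm_nonneg _) (by positivity) two_ne_zero).1
          (((norm_highPass_sq_le (h (θ n)) hM0).trans ?_).trans hM)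
        exact div_le_div_of_nonneg_right (hB _) (by positivity)
      have e : f (θ n) - k n = restrictTo (measurableSet_closedBall_zero R) (highPass M (f (θ n)))
          + restrictTo (measurableSet_closedBall_zero R).compl (f (θ n)) := by
        have e1 := restrictTo_add_restrictTo_compl (measurableSet_closedBall_zero R) (f (θ n))
        have e2 := restrictTo_add (measurableSet_closedBall_zero R) (lowPass M (f (θ n)))
          (highPass M (f (θ n)))
        rw [lowPass_add_highPass] at e2
        rw [e2] at e1
        rw [sub_eq_iff_eq_add]
        refine e1.symm.trans ?_
        simp only [k]
        abel
      rw [e]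
      refine (norm_add_le _ _).trans ?_
      have := (norm_restrictTo_le (measurableSet_closedBall_zero R) (highPass M (f (θ n)))).trans
        hhigh
      linarith [hR (θ n)]
    obtain ⟨N, hN⟩ := Metric.cauchySeq_iff.1 hk (ε / 3) (by positivity)
    refine ⟨N, fun m hm n hn => ?_⟩
    have h1 := hN m hm n hn
    rw [dist_eq_norm] at h1 ⊢
    have e : (f ∘ θ) m - (f ∘ θ) n = (f (θ m) - k m) + (k m - k n) - (f (θ n) - k n) := by
      simp only [Function.comp]; abel
    rw [e]
    refine (norm_sub_le _ _).trans_lt ?_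
    have := norm_add_le (f (θ m) - k m) (k m - k n)
    linarith [hclose m, hclose n]
  obtain ⟨v, hv⟩ := cauchySeq_tendsto_of_complete hcauchy
  exact ⟨v, hθ, hv⟩

/-! ### The energy space -/

theorem hasWeakPartial_weakPartial {V : Space d → ℝ} {φ : L2 d} (hφ : φ ∈ energySpace V)
    (i : Fin d) : HasWeakPartial i φ (weakPartial i φ) := by
  obtain ⟨g, hg⟩ := hφ.1 i
  rw [weakPartial_eq hg]
  exact hg

theorem aestronglyMeasurable_potential {V : Space d → ℝ} (hVm : AEMeasurable V volume) (φ : L2 d) :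
    AEStronglyMeasurable (fun x => V x * ‖φ x‖ ^ 2) volume :=
  hVm.aestronglyMeasurable.mul ((Lp.aestronglyMeasurable φ).norm.pow 2)

theorem energySpace_add {V : Space d → ℝ} (hVm : AEMeasurable V volume) (hV0 : ∀ x, 0 ≤ V x)
    {φ ψ : L2 d} (hφ : φ ∈ energySpace V) (hψ : ψ ∈ energySpace V) : φ + ψ ∈ energySpace V := by
  refine ⟨fun i => ⟨_, (hasWeakPartial_weakPartial hφ i).add (hasWeakPartial_weakPartial hψ i)⟩,
    Integrable.mono' ((hφ.2.const_mul 2).add (hψ.2.const_mul 2))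
      (aestronglyMeasurable_potential hVm _) ?_⟩
  filter_upwards [Lp.coeFn_add φ ψ] with x hx
  have h0 := hV0 x
  rw [Real.norm_of_nonneg (by positivity), hx, Pi.add_apply]
  have h1 : ‖φ x + ψ x‖ ^ 2 ≤ 2 * ‖φ x‖ ^ 2 + 2 * ‖ψ x‖ ^ 2 := by
    have h2 : ‖φ x + ψ x‖ ^ 2 ≤ (‖φ x‖ + ‖ψ x‖) ^ 2 :=
      pow_le_pow_left₀ (norm_nonneg _) (norm_add_le _ _) 2
    nlinarith [sq_nonneg (‖φ x‖ - ‖ψ x‖)]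
  simp only [Pi.add_apply]
  nlinarith [mul_le_mul_of_nonneg_left h1 h0]

theorem energySpace_smul {V : Space d → ℝ} {φ : L2 d} (c : ℂ) (hφ : φ ∈ energySpace V) :
    c • φ ∈ energySpace V := by
  refine ⟨fun i => ⟨_, (hasWeakPartial_weakPartial hφ i).smul c⟩,
    (hφ.2.const_mul (‖c‖ ^ 2)).congr ?_⟩
  filter_upwards [Lp.coeFn_smul c φ] with x hx
  rw [hx, Pi.smul_apply, norm_smul]
  ring

theorem energySpace_sub {V : Space d → ℝ} (hVm : AEMeasurable V volume) (hV0 : ∀ x, 0 ≤ V x)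
    {φ ψ : L2 d} (hφ : φ ∈ energySpace V) (hψ : ψ ∈ energySpace V) : φ - ψ ∈ energySpace V := by
  have := energySpace_add hVm hV0 hφ (energySpace_smul (-1) hψ)
  rwa [neg_one_smul, ← sub_eq_add_neg] at this

theorem weakPartial_add {V : Space d → ℝ} {φ ψ : L2 d} (hφ : φ ∈ energySpace V)
    (hψ : ψ ∈ energySpace V) (i : Fin d) :
    weakPartial i (φ + ψ) = weakPartial i φ + weakPartial i ψ :=
  weakPartial_eq ((hasWeakPartial_weakPartial hφ i).add (hasWeakPartial_weakPartial hψ i))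

theorem weakPartial_smul {V : Space d → ℝ} {φ : L2 d} (c : ℂ) (hφ : φ ∈ energySpace V)
    (i : Fin d) : weakPartial i (c • φ) = c • weakPartial i φ :=
  weakPartial_eq ((hasWeakPartial_weakPartial hφ i).smul c)

theorem weakPartial_sub {V : Space d → ℝ} {φ ψ : L2 d} (hφ : φ ∈ energySpace V)
    (hψ : ψ ∈ energySpace V) (i : Fin d) :
    weakPartial i (φ - ψ) = weakPartial i φ - weakPartial i ψ := by
  refine weakPartial_eq ?_
  have := (hasWeakPartial_weakPartial hφ i).add ((hasWeakPartial_weakPartial hψ i).smul (-1))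
  rwa [neg_one_smul, neg_one_smul, ← sub_eq_add_neg, ← sub_eq_add_neg] at this

theorem integral_mul_conj_eq_inner (f g : L2 d) : ∫ x, f x * conj (g x) = inner ℂ g f := by
  rw [L2.inner_def]
  simp [RCLike.inner_apply]

theorem integrable_potential_mul_conj {V : Space d → ℝ} (hVm : AEMeasurable V volume)
    (hV0 : ∀ x, 0 ≤ V x) {φ v : L2 d} (hφ : φ ∈ energySpace V) (hv : v ∈ energySpace V) :
    Integrable fun x => (V x : ℂ) * φ x * conj (v x) := by
  refine Integrable.mono' (hφ.2.add hv.2) ?_ (.of_forall fun x => ?_)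
  · exact ((Complex.measurable_ofReal.comp_aemeasurable hVm).aestronglyMeasurable.mul
      (Lp.aestronglyMeasurable φ)).mul (Lp.aestronglyMeasurable v).star
  · have h0 := hV0 x
    simp only [norm_mul, Complex.norm_real, RCLike.norm_conj, Pi.add_apply,
      Real.norm_of_nonneg h0]
    have : ‖φ x‖ * ‖v x‖ ≤ ‖φ x‖ ^ 2 + ‖v x‖ ^ 2 := by
      nlinarith [sq_nonneg (‖φ x‖ - ‖v x‖), sq_nonneg (‖φ x‖), sq_nonneg (‖v x‖)]
    nlinarith [mul_le_mul_of_nonneg_left this h0]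

/-- A weight whose square is dominated by `K (V + C)` maps the energy space to `L²`. -/
theorem memLp_weight_mul {V : Space d → ℝ} {w : Space d → ℝ} (hw : Continuous w)
    {K C : ℝ} (hC : ∀ x, w x ^ 2 ≤ K * (V x + C)) {φ : L2 d} (hφ : φ ∈ energySpace V) :
    MemLp (fun x => (w x : ℂ) * φ x) 2 volume := by
  have hm : AEStronglyMeasurable (fun x => (w x : ℂ) * φ x) volume :=
    (Complex.continuous_ofReal.comp hw).aestronglyMeasurable.mul (Lp.aestronglyMeasurable φ)
  rw [memLp_two_iff_integrable_sq_norm hm]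
  refine Integrable.mono' ((hφ.2.const_mul K).add ((integrable_norm_sq φ).const_mul (K * C)))
    (hm.norm.pow 2) (.of_forall fun x => ?_)
  rw [Real.norm_of_nonneg (by positivity), norm_mul, mul_pow, Complex.norm_real, Real.norm_eq_abs,
    sq_abs]
  simp only [Pi.add_apply]
  nlinarith [mul_le_mul_of_nonneg_right (hC x) (sq_nonneg ‖φ x‖)]

/-! ### The angular momentum form -/

/-- The product rule for a test function and a weakly differentiable function. -/
theorem HasWeakPartial.mul_test {i : Fin d} {f f' u u' : L2 d} (h : HasWeakPartial i f f')
    {η : Space d → ℝ} (hη : ContDiff ℝ (⊤ : ℕ∞) η)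
    (hu : ∀ᵐ x, u x = η x * f x)
    (hu' : ∀ᵐ x, u' x = η x * f' x + (fderiv ℝ η x (EuclideanSpace.single i 1) : ℝ) * f x) :
    HasWeakPartial i u u' := by
  intro ψ hψ hc
  set e : Space d := EuclideanSpace.single i 1
  have hmain := h (fun x => ψ x * η x) (hψ.mul hη) (hc.mul_right)
  have hd : ∀ x, fderiv ℝ (fun x => ψ x * η x) x e
      = ψ x * fderiv ℝ η x e + fderiv ℝ ψ x e * η x := fun x => by
    rw [fderiv_fun_mul (hψ.differentiable (by simp) x) (hη.differentiable (by simp) x)]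
    simp [mul_comm]
  have i1 : Integrable fun x => (ψ x * fderiv ℝ η x e) • f x :=
    integrable_smul_of_hasCompactSupport f (hψ.continuous.mul (continuous_partial hη e))
      hc.mul_right
  have i2 : Integrable fun x => (fderiv ℝ ψ x e * η x) • f x :=
    integrable_smul_of_hasCompactSupport f ((continuous_partial hψ e).mul hη.continuous)
      (hasCompactSupport_partial hc e).mul_right
  have i3 : Integrable fun x => (ψ x * η x) • f' x :=
    integrable_smul_of_hasCompactSupport f' (hψ.continuous.mul hη.continuous) hc.mul_right
  change ∫ x, fderiv ℝ (fun x => ψ x * η x) x e • f x = _ at hmain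
  simp only [hd, add_smul] at hmain
  rw [integral_add i1 i2] at hmain
  have e1 : ∫ x, fderiv ℝ ψ x e • u x = ∫ x, (fderiv ℝ ψ x e * η x) • f x := by
    refine integral_congr_ae ?_
    filter_upwards [hu] with x hx
    rw [hx]
    simp only [Complex.real_smul]
    push_cast
    ring
  have e2 : ∫ x, ψ x • u' x
      = (∫ x, (ψ x * η x) • f' x) + ∫ x, (ψ x * fderiv ℝ η x e) • f x := by
    rw [← integral_add i3 i1]
    refine integral_congr_ae ?_
    filter_upwards [hu'] with x hx
    rw [hx]
    simp only [Complex.real_smul]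
    push_cast
    ring
  rw [e1, e2, neg_add, ← hmain]
  ring

/-- The operator `x_j ∂_i`, `i ≠ j`, is skew-symmetric. The weight `x_j` is cut off, which
produces an error `x_j ∂_i χ_n` that is bounded and tends to zero pointwise. -/
theorem integral_coord_mul_weakPartial {i j : Fin d} (hij : i ≠ j) {f f' g g' : L2 d}
    (hf : HasWeakPartial i f f') (hg : HasWeakPartial i g g')
    (hfj : MemLp (fun x => ((x j : ℝ) : ℂ) * f x) 2 volume)
    (hgj : MemLp (fun x => ((x j : ℝ) : ℂ) * g x) 2 volume) :
    ∫ x, ((x j : ℝ) : ℂ) * (conj (f' x) * g x) = -∫ x, ((x j : ℝ) : ℂ) * (conj (f x) * g' x) := by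
  obtain ⟨χ, hχs, hχc, hχt, -, hχx⟩ := exists_cutoff_tendsto d
  set e : Space d := EuclideanSpace.single i 1
  have i1 : Integrable fun x => ((x j : ℝ) : ℂ) * (conj (f' x) * g x) := by
    have := (Lp.memLp f').star.integrable_mul (q := 2) hgj
    refine this.congr (.of_forall fun x => ?_)
    simp; ring
  have i2 : Integrable fun x => ((x j : ℝ) : ℂ) * (conj (f x) * g' x) := by
    have := hfj.star.integrable_mul (q := 2) (Lp.memLp g')
    refine this.congr (.of_forall fun x => ?_)
    simp; ring
  have i3 : Integrable fun x => conj (f x) * g x :=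
    (Lp.memLp f).star.integrable_mul (q := 2) (Lp.memLp g)
  have key : ∀ n, (∫ x, (χ n x : ℂ) * (((x j : ℝ) : ℂ) * (conj (f' x) * g x)))
      + (∫ x, ((x j * fderiv ℝ (χ n) x e : ℝ) : ℂ) * (conj (f x) * g x))
      = -∫ x, (χ n x : ℂ) * (((x j : ℝ) : ℂ) * (conj (f x) * g' x)) := by
    intro n
    set η : Space d → ℝ := fun x => χ n x * x j
    have hηs : ContDiff ℝ (⊤ : ℕ∞) η := (hχs n).mul (by fun_prop)
    have hηc : HasCompactSupport η := (hχc n).mul_right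
    have hηd : ∀ x, fderiv ℝ η x e = x j * fderiv ℝ (χ n) x e := fun x => by
      have h1 := ((hχs n).differentiable (by simp) x).hasFDerivAt
      have h2 : HasFDerivAt (fun x : Space d => x j) (EuclideanSpace.proj j : Space d →L[ℝ] ℝ) x :=
        (EuclideanSpace.proj j : Space d →L[ℝ] ℝ).hasFDerivAt
      have h3 : fderiv ℝ η x = χ n x • (EuclideanSpace.proj j : Space d →L[ℝ] ℝ)
          + x j • fderiv ℝ (χ n) x := (h1.mul h2).fderiv
      rw [h3]
      simp [e, hij.symm]
    have hmem : ∀ {θ : Space d → ℝ} (u : L2 d), Continuous θ → HasCompactSupport θ →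
        MemLp (fun x => (θ x : ℂ) * u x) 2 volume := fun {θ} u hθ hθc => by
      obtain ⟨C, hC⟩ := hθ.bounded_above_of_compact_support hθc
      refine MemLp.of_le_mul (c := C) (Lp.memLp u)
        ((Complex.continuous_ofReal.comp hθ).aestronglyMeasurable.mul (Lp.aestronglyMeasurable u))
        (.of_forall fun x => ?_)
      rw [norm_mul, Complex.norm_real]
      exact mul_le_mul_of_nonneg_right (hC x) (norm_nonneg _)
    have hm := hmem f hηs.continuous hηc
    have hm' := (hmem f' hηs.continuous hηc).add
      (hmem f (continuous_partial hηs e) (hasCompactSupport_partial hηc e))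
    have hw : HasWeakPartial i (hm.toLp _) (hm'.toLp _) :=
      hf.mul_test hηs hm.coeFn_toLp hm'.coeFn_toLp
    have h1 := hw.inner_eq_neg hg
    rw [L2.inner_def, L2.inner_def] at h1
    have hr : ∀ {F : Space d → ℂ} {θ : Space d → ℝ}, Integrable F → Continuous θ →
        HasCompactSupport θ → Integrable fun x => (θ x : ℂ) * F x := fun {F θ} hF hθ hθc => by
      obtain ⟨C, hC⟩ := hθ.bounded_above_of_compact_support hθc
      exact hF.bdd_mul (c := C) (Complex.continuous_ofReal.comp hθ).aestronglyMeasurable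
        (.of_forall fun x => by simpa using hC x)
    have hd1 : Integrable fun x => ((x j * fderiv ℝ (χ n) x e : ℝ) : ℂ) * (conj (f x) * g x) := by
      have := hr i3 (continuous_partial hηs e) (hasCompactSupport_partial hηc e)
      simpa only [hηd] using this
    rw [← integral_add (hr i1 (hχs n).continuous (hχc n)) hd1]
    calc _ = ∫ x, inner ℂ ((hm'.toLp _ : L2 d) x) (g x) := by
          refine integral_congr_ae ?_
          filter_upwards [hm'.coeFn_toLp] with x hx
          rw [hx]
          simp only [Pi.add_apply, RCLike.inner_apply, map_add, map_mul,
            Complex.conj_ofReal, η, hηd]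
          push_cast
          ring
      _ = -∫ x, inner ℂ ((hm.toLp _ : L2 d) x) (g' x) := h1
      _ = _ := by
          congr 1
          refine integral_congr_ae ?_
          filter_upwards [hm.coeFn_toLp] with x hx
          rw [hx]
          simp only [RCLike.inner_apply, map_mul, Complex.conj_ofReal, η]
          push_cast
          ring
  have lim := tendsto_nhds_unique (((hχt i1).add (hχx e j i3)).congr key) (hχt i2).neg
  rwa [add_zero] at lim

/-- The potential dominates the centrifugal term for a speed `γ > |Ω|`, or there is no rotation. -/
def ControlsRotation (V : Space d → ℝ) (Ω : ℝ) : Prop :=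
  Ω = 0 ∨ ∃ γ C : ℝ, |Ω| < γ ∧ 0 ≤ C ∧ ∀ x, γ ^ 2 / 2 * planarRadiusSq x ≤ V x + C

/-- The form `(φ, v) ↦ Ω ∫ (L_z φ) v̄`. -/
noncomputable def angularForm (Ω : ℝ) (φ v : L2 d) : ℂ :=
  (Ω : ℂ) * ∫ x, angularMomentum φ x * conj (v x)

/-- Either the angular momentum form vanishes, or the planar coordinates map the energy space
to `L²`. -/
theorem ControlsRotation.cases {V : Space d → ℝ} {Ω : ℝ} (hR : ControlsRotation V Ω) :
    (∀ φ v : L2 d, angularForm Ω φ v = 0) ∨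
    ∃ (h : 2 ≤ d) (γ C : ℝ), |Ω| < γ ∧ 0 ≤ C ∧
      (∀ x : Space d, γ ^ 2 / 2 * (x ⟨0, by omega⟩ ^ 2 + x ⟨1, by omega⟩ ^ 2) ≤ V x + C) ∧
      (∀ φ ∈ energySpace V, MemLp (fun x => ((x ⟨0, by omega⟩ : ℝ) : ℂ) * φ x) 2 volume) ∧
      (∀ φ ∈ energySpace V, MemLp (fun x => ((x ⟨1, by omega⟩ : ℝ) : ℂ) * φ x) 2 volume) := by
  rcases hR with rfl | ⟨γ, C, hγ, hC, hV⟩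
  · exact .inl fun φ v => by simp [angularForm]
  by_cases h : 2 ≤ d
  · right
    have hγ0 : 0 < γ := (abs_nonneg _).trans_lt hγ
    simp only [planarRadiusSq, dif_pos h] at hV
    refine ⟨h, γ, C, hγ, hC, hV, fun φ hφ => ?_, fun φ hφ => ?_⟩
    · refine memLp_weight_mul (K := 2 / γ ^ 2) (C := C) (by fun_prop) (fun x => ?_) hφ
      rw [div_mul_eq_mul_div, le_div_iff₀ (by positivity)]
      nlinarith [hV x, mul_nonneg (sq_nonneg γ) (sq_nonneg (x ⟨1, by omega⟩))]
    · refine memLp_weight_mul (K := 2 / γ ^ 2) (C := C) (by fun_prop) (fun x => ?_) hφ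
      rw [div_mul_eq_mul_div, le_div_iff₀ (by positivity)]
      nlinarith [hV x, mul_nonneg (sq_nonneg γ) (sq_nonneg (x ⟨0, by omega⟩))]
  · exact .inl fun φ v => by simp [angularForm, angularMomentum, h]

theorem angularMomentum_of_two_le (h : 2 ≤ d) (φ : L2 d) (x : Space d) :
    angularMomentum φ x = Complex.I * ((x ⟨1, by omega⟩ : ℂ) * weakPartial ⟨0, by omega⟩ φ x
      - (x ⟨0, by omega⟩ : ℂ) * weakPartial ⟨1, by omega⟩ φ x) :=
  dif_pos h

theorem integrable_coord_mul {j : Fin d} (f : L2 d) {v : L2 d}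
    (hv : MemLp (fun x => ((x j : ℝ) : ℂ) * v x) 2 volume) :
    Integrable fun x => ((x j : ℝ) : ℂ) * (conj (v x) * f x) := by
  refine (hv.star.integrable_mul (q := 2) (Lp.memLp f)).congr (.of_forall fun x => ?_)
  simp; ring

theorem angularForm_of_two_le (h : 2 ≤ d) (Ω : ℝ) (φ : L2 d) {v : L2 d}
    (h0 : MemLp (fun x : Space d => ((x ⟨0, by omega⟩ : ℝ) : ℂ) * v x) 2 volume)
    (h1 : MemLp (fun x : Space d => ((x ⟨1, by omega⟩ : ℝ) : ℂ) * v x) 2 volume) :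
    angularForm Ω φ v = Ω * (Complex.I *
      ((∫ x, ((x ⟨1, by omega⟩ : ℝ) : ℂ) * (conj (v x) * weakPartial ⟨0, by omega⟩ φ x))
        - ∫ x, ((x ⟨0, by omega⟩ : ℝ) : ℂ) * (conj (v x) * weakPartial ⟨1, by omega⟩ φ x))) := by
  rw [angularForm, ← integral_sub (integrable_coord_mul _ h1) (integrable_coord_mul _ h0),
    ← integral_const_mul Complex.I]
  refine congrArg ((Ω : ℂ) * ·) (integral_congr_ae (.of_forall fun x => ?_))
  simp only [angularMomentum_of_two_le h]
  ring

theorem integral_coord_mul_add {j : Fin d} (f g : L2 d) {v : L2 d}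
    (hv : MemLp (fun x => ((x j : ℝ) : ℂ) * v x) 2 volume) :
    ∫ x, ((x j : ℝ) : ℂ) * (conj (v x) * (f + g : L2 d) x)
      = (∫ x, ((x j : ℝ) : ℂ) * (conj (v x) * f x))
        + ∫ x, ((x j : ℝ) : ℂ) * (conj (v x) * g x) := by
  rw [← integral_add (integrable_coord_mul _ hv) (integrable_coord_mul _ hv)]
  refine integral_congr_ae ?_
  filter_upwards [Lp.coeFn_add f g] with x hx
  rw [hx, Pi.add_apply]
  ring

theorem integral_coord_mul_smul {j : Fin d} (c : ℂ) (f v : L2 d) :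
    ∫ x : Space d, ((x j : ℝ) : ℂ) * (conj (v x) * (c • f : L2 d) x)
      = c * ∫ x : Space d, ((x j : ℝ) : ℂ) * (conj (v x) * f x) := by
  rw [← integral_const_mul]
  refine integral_congr_ae ?_
  filter_upwards [Lp.coeFn_smul c f] with x hx
  rw [hx, Pi.smul_apply, smul_eq_mul]
  ring

theorem angularForm_add_left {V : Space d → ℝ} {Ω : ℝ} (hR : ControlsRotation V Ω)
    {φ ψ v : L2 d} (hφ : φ ∈ energySpace V) (hψ : ψ ∈ energySpace V) (hv : v ∈ energySpace V) :
    angularForm Ω (φ + ψ) v = angularForm Ω φ v + angularForm Ω ψ v := by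
  rcases hR.cases with h0 | ⟨h, γ, C, -, -, -, hm0, hm1⟩
  · simp [h0]
  · rw [angularForm_of_two_le h Ω _ (hm0 v hv) (hm1 v hv),
      angularForm_of_two_le h Ω _ (hm0 v hv) (hm1 v hv),
      angularForm_of_two_le h Ω _ (hm0 v hv) (hm1 v hv), weakPartial_add hφ hψ,
      weakPartial_add hφ hψ, integral_coord_mul_add _ _ (hm0 v hv),
      integral_coord_mul_add _ _ (hm1 v hv)]
    ring

theorem angularForm_smul_left {V : Space d → ℝ} {Ω : ℝ} (hR : ControlsRotation V Ω)
    {φ v : L2 d} (c : ℂ) (hφ : φ ∈ energySpace V) (hv : v ∈ energySpace V) :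
    angularForm Ω (c • φ) v = c * angularForm Ω φ v := by
  rcases hR.cases with h0 | ⟨h, γ, C, -, -, -, hm0, hm1⟩
  · simp [h0]
  · rw [angularForm_of_two_le h Ω _ (hm0 v hv) (hm1 v hv),
      angularForm_of_two_le h Ω _ (hm0 v hv) (hm1 v hv), weakPartial_smul c hφ,
      weakPartial_smul c hφ, integral_coord_mul_smul, integral_coord_mul_smul]
    ring

/-- The angular momentum operator is symmetric on the energy space. -/
theorem angularForm_conj {V : Space d → ℝ} {Ω : ℝ} (hR : ControlsRotation V Ω)
    {φ v : L2 d} (hφ : φ ∈ energySpace V) (hv : v ∈ energySpace V) :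
    conj (angularForm Ω v φ) = angularForm Ω φ v := by
  rcases hR.cases with h0 | ⟨h, γ, C, -, -, -, hm0, hm1⟩
  · simp [h0]
  · rw [angularForm_of_two_le h Ω _ (hm0 v hv) (hm1 v hv),
      angularForm_of_two_le h Ω _ (hm0 φ hφ) (hm1 φ hφ)]
    have hw := fun (u : L2 d) (hu : u ∈ energySpace V) (i : Fin d) =>
      hasWeakPartial_weakPartial hu i
    have e1 := integral_coord_mul_weakPartial (i := (⟨0, by omega⟩ : Fin d)) (j := ⟨1, by omega⟩)
      (by simp) (hw v hv _) (hw φ hφ _) (hm1 v hv) (hm1 φ hφ)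
    have e2 := integral_coord_mul_weakPartial (i := (⟨1, by omega⟩ : Fin d)) (j := ⟨0, by omega⟩)
      (by simp) (hw v hv _) (hw φ hφ _) (hm0 v hv) (hm0 φ hφ)
    have cj : ∀ (j : Fin d) (f : L2 d),
        conj (∫ x : Space d, ((x j : ℝ) : ℂ) * (conj (φ x) * f x))
          = ∫ x : Space d, ((x j : ℝ) : ℂ) * (conj (f x) * φ x) := by
      intro j f
      rw [← integral_conj]
      refine integral_congr_ae (.of_forall fun x => ?_)
      simp only [map_mul, Complex.conj_ofReal, Complex.conj_conj]
      ring
    simp only [map_mul, map_sub, cj, Complex.conj_ofReal, Complex.conj_I]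
    rw [e1, e2]
    ring

/-- The rotation term is dominated, with a constant less than one, by kinetic and potential
energy. -/
theorem exists_angularForm_bound {V : Space d → ℝ} {Ω : ℝ}
    (hR : ControlsRotation V Ω) : ∃ θ C : ℝ, 0 ≤ θ ∧ θ < 1 ∧ 0 ≤ C ∧ ∀ φ ∈ energySpace V,
      ‖angularForm Ω φ φ‖ ≤
        θ * (1 / 2 * (∑ i, ‖weakPartial i φ‖ ^ 2) + ∫ x, V x * ‖φ x‖ ^ 2) + C * ‖φ‖ ^ 2 := by
  rcases hR.cases with h0 | ⟨h, γ, C, hγ, hC, hV, hm0, hm1⟩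
  · refine ⟨0, 0, le_rfl, one_pos, le_rfl, fun φ _ => ?_⟩
    simp [h0]
  · have hγ0 : 0 < γ := (abs_nonneg _).trans_lt hγ
    have hθ1 : |Ω| / γ < 1 := (div_lt_one hγ0).2 hγ
    refine ⟨|Ω| / γ, |Ω| / γ * C, by positivity, hθ1, by positivity, fun φ hφ => ?_⟩
    set i0 : Fin d := ⟨0, by omega⟩
    set i1 : Fin d := ⟨1, by omega⟩
    set G : Space d → ℝ := fun x => 1 / 2 * (‖weakPartial i0 φ x‖ ^ 2 + ‖weakPartial i1 φ x‖ ^ 2)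
      + (V x * ‖φ x‖ ^ 2 + C * ‖φ x‖ ^ 2) with hG
    have hGi : Integrable G := (((integrable_norm_sq _).add (integrable_norm_sq _)).const_mul _).add
      (hφ.2.add ((integrable_norm_sq φ).const_mul C))
    have hpt : ∀ x, γ * ‖angularMomentum φ x * conj (φ x)‖ ≤ G x := by
      intro x
      rw [angularMomentum_of_two_le h, norm_mul, norm_mul, Complex.norm_I, one_mul,
        RCLike.norm_conj]
      set a := ‖weakPartial i0 φ x‖
      set b := ‖weakPartial i1 φ x‖
      set y := ‖φ x‖
      have hy : 0 ≤ y := norm_nonneg _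
      have n1 : ‖((x i1 : ℝ) : ℂ) * weakPartial i0 φ x - ((x i0 : ℝ) : ℂ) * weakPartial i1 φ x‖
          ≤ |x i1| * a + |x i0| * b := by
        refine (norm_sub_le _ _).trans (le_of_eq ?_)
        simp [a, b]
      have n2 : γ * (‖((x i1 : ℝ) : ℂ) * weakPartial i0 φ x
          - ((x i0 : ℝ) : ℂ) * weakPartial i1 φ x‖ * y) ≤ γ * ((|x i1| * a + |x i0| * b) * y) := by
        gcongr
      refine n2.trans ?_
      have q1 := sq_nonneg (a - γ * |x i1| * y)
      have q2 := sq_nonneg (b - γ * |x i0| * y)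
      have q3 := mul_le_mul_of_nonneg_right (hV x) (sq_nonneg y)
      have s1 := sq_abs (x i1)
      have s0 := sq_abs (x i0)
      rw [← s0, ← s1] at q3
      simp only [G]
      nlinarith
    have hsum : ‖weakPartial i0 φ‖ ^ 2 + ‖weakPartial i1 φ‖ ^ 2 ≤ ∑ i, ‖weakPartial i φ‖ ^ 2 := by
      have hne : i0 ≠ i1 := by simp [i0, i1]
      rw [← Finset.sum_pair (f := fun i => ‖weakPartial i φ‖ ^ 2) hne]
      exact Finset.sum_le_sum_of_subset_of_nonneg (Finset.subset_univ _)
        fun _ _ _ => by positivity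
    have hint : ∫ x, G x = 1 / 2 * (‖weakPartial i0 φ‖ ^ 2 + ‖weakPartial i1 φ‖ ^ 2)
        + ((∫ x, V x * ‖φ x‖ ^ 2) + C * ‖φ‖ ^ 2) := by
      have e1 : Integrable fun x => 1 / 2 * (‖weakPartial i0 φ x‖ ^ 2 + ‖weakPartial i1 φ x‖ ^ 2) :=
        ((integrable_norm_sq _).add (integrable_norm_sq _)).const_mul _
      have e2 : Integrable fun x => C * ‖φ x‖ ^ 2 := (integrable_norm_sq φ).const_mul C
      have e3 : Integrable fun x => V x * ‖φ x‖ ^ 2 + C * ‖φ x‖ ^ 2 := hφ.2.add e2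
      simp only [hG]
      rw [integral_add e1 e3, integral_const_mul,
        integral_add (integrable_norm_sq _) (integrable_norm_sq _), integral_add hφ.2 e2,
        integral_const_mul]
      simp only [← norm_sq_eq_integral]
    have hb : ‖∫ x, angularMomentum φ x * conj (φ x)‖ ≤ γ⁻¹ * ∫ x, G x := by
      rw [← integral_const_mul]
      refine norm_integral_le_of_norm_le (hGi.const_mul _) (.of_forall fun x => ?_)
      rw [← div_eq_inv_mul, le_div_iff₀ hγ0, mul_comm]
      exact hpt x
    rw [angularForm, norm_mul, Complex.norm_real, Real.norm_eq_abs]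
    calc _ ≤ |Ω| * (γ⁻¹ * ∫ x, G x) := by gcongr
      _ = |Ω| / γ * ∫ x, G x := by ring
      _ ≤ |Ω| / γ * (1 / 2 * (∑ i, ‖weakPartial i φ‖ ^ 2)
          + ((∫ x, V x * ‖φ x‖ ^ 2) + C * ‖φ‖ ^ 2)) := by
        rw [hint]; gcongr
      _ = _ := by ring

/-- Rotation at speeds below the maximal speed is dominated by the potential. -/
theorem controlsRotation_of_lt_maxSpeed {V : Space d → ℝ} (hV0 : ∀ x, 0 ≤ V x) {Ω : ℝ}
    (hΩ : Ω = 0 ∨ (0 < |Ω| ∧ ((|Ω| : ℝ) : EReal) < maxSpeed V)) : ControlsRotation V Ω := by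
  rcases hΩ with h | ⟨-, h⟩
  · exact .inl h
  right
  obtain ⟨_, ⟨γ, ⟨hγ0, hlim⟩, rfl⟩, hγ⟩ := lt_sSup_iff.1 h
  have hγ' : |Ω| < γ := EReal.coe_lt_coe_iff.1 hγ
  obtain ⟨K, hK, hKc⟩ := mem_cocompact.1 (hlim.eventually_ge_atTop 0)
  have hcont : Continuous fun x : Space d => planarRadiusSq x := by
    unfold planarRadiusSq
    split_ifs <;> fun_prop
  obtain ⟨C, hC⟩ := hK.bddAbove_image (hcont.const_mul (γ ^ 2 / 2)).continuousOn
  refine ⟨γ, max C 0, hγ', le_max_right _ _, fun x => ?_⟩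
  by_cases hx : x ∈ K
  · have := hC (Set.mem_image_of_mem _ hx)
    linarith [hV0 x, le_max_left C 0]
  · have : 0 ≤ V x - γ ^ 2 / 2 * planarRadiusSq x := hKc hx
    linarith [le_max_right C 0]

/-! ### The quadratic form -/

/-- The sesquilinear form of `-½Δ + V - Ω L_z`. -/
noncomputable def linearForm (V : Space d → ℝ) (Ω : ℝ) (φ v : L2 d) : ℂ :=
  1 / 2 * (∑ i, ∫ x, weakPartial i φ x * conj (weakPartial i v x))
    + (∫ x, (V x : ℂ) * φ x * conj (v x))
    - (Ω : ℂ) * (∫ x, angularMomentum φ x * conj (v x))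

/-- Kinetic and potential energy, without rotation. -/
noncomputable def staticEnergy (V : Space d → ℝ) (φ : L2 d) : ℝ :=
  1 / 2 * (∑ i, ‖weakPartial i φ‖ ^ 2) + ∫ x, V x * ‖φ x‖ ^ 2

theorem staticEnergy_nonneg {V : Space d → ℝ} (hV0 : ∀ x, 0 ≤ V x) (φ : L2 d) :
    0 ≤ staticEnergy V φ :=
  add_nonneg (by positivity)
    (integral_nonneg fun x => mul_nonneg (hV0 x) (sq_nonneg _))

theorem linearForm_add_left {V : Space d → ℝ} (hVm : AEMeasurable V volume)
    (hV0 : ∀ x, 0 ≤ V x) {Ω : ℝ} (hR : ControlsRotation V Ω) {φ ψ v : L2 d}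
    (hφ : φ ∈ energySpace V) (hψ : ψ ∈ energySpace V) (hv : v ∈ energySpace V) :
    linearForm V Ω (φ + ψ) v = linearForm V Ω φ v + linearForm V Ω ψ v := by
  have h1 := angularForm_add_left hR hφ hψ hv
  have h2 : ∀ i, ∫ x, weakPartial i (φ + ψ) x * conj (weakPartial i v x)
      = (∫ x, weakPartial i φ x * conj (weakPartial i v x))
        + ∫ x, weakPartial i ψ x * conj (weakPartial i v x) := fun i => by
    simp only [integral_mul_conj_eq_inner, weakPartial_add hφ hψ, inner_add_right]
  have h3 : ∫ x, (V x : ℂ) * (φ + ψ : L2 d) x * conj (v x)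
      = (∫ x, (V x : ℂ) * φ x * conj (v x)) + ∫ x, (V x : ℂ) * ψ x * conj (v x) := by
    rw [← integral_add (integrable_potential_mul_conj hVm hV0 hφ hv)
      (integrable_potential_mul_conj hVm hV0 hψ hv)]
    refine integral_congr_ae ?_
    filter_upwards [Lp.coeFn_add φ ψ] with x hx
    rw [hx, Pi.add_apply]
    ring
  simp only [angularForm] at h1
  simp only [linearForm, h1, h2, h3, Finset.sum_add_distrib]
  ring

theorem linearForm_smul_left {V : Space d → ℝ} {Ω : ℝ} (hR : ControlsRotation V Ω) {φ v : L2 d}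
    (c : ℂ) (hφ : φ ∈ energySpace V) (hv : v ∈ energySpace V) :
    linearForm V Ω (c • φ) v = c * linearForm V Ω φ v := by
  have h1 := angularForm_smul_left hR c hφ hv
  have h2 : ∀ i, ∫ x, weakPartial i (c • φ) x * conj (weakPartial i v x)
      = c * (∫ x, weakPartial i φ x * conj (weakPartial i v x)) := fun i => by
    simp only [integral_mul_conj_eq_inner, weakPartial_smul c hφ, inner_smul_right]
  have h3 : ∫ x, (V x : ℂ) * (c • φ : L2 d) x * conj (v x)
      = c * (∫ x, (V x : ℂ) * φ x * conj (v x)) := by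
    rw [← integral_const_mul]
    refine integral_congr_ae ?_
    filter_upwards [Lp.coeFn_smul c φ] with x hx
    rw [hx, Pi.smul_apply, smul_eq_mul]
    ring
  simp only [angularForm] at h1
  simp only [linearForm, h1, h2, h3, ← Finset.mul_sum]
  ring

theorem linearForm_conj {V : Space d → ℝ} {Ω : ℝ} (hR : ControlsRotation V Ω) {φ v : L2 d}
    (hφ : φ ∈ energySpace V) (hv : v ∈ energySpace V) :
    conj (linearForm V Ω v φ) = linearForm V Ω φ v := by
  have h1 := angularForm_conj hR hφ hv
  have h2 : ∀ i, conj (∫ x, weakPartial i v x * conj (weakPartial i φ x))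
      = ∫ x, weakPartial i φ x * conj (weakPartial i v x) := fun i => by
    simp only [integral_mul_conj_eq_inner, inner_conj_symm]
  have h3 : conj (∫ x, (V x : ℂ) * v x * conj (φ x)) = ∫ x, (V x : ℂ) * φ x * conj (v x) := by
    rw [← integral_conj]
    refine integral_congr_ae (.of_forall fun x => ?_)
    simp only [map_mul, Complex.conj_ofReal, Complex.conj_conj]
    ring
  simp only [angularForm] at h1
  have h4 : conj (1 / 2 : ℂ) = 1 / 2 := by simp [map_ofNat]
  rw [linearForm, map_sub, map_add, map_mul, map_sum, h1, h3, h4, linearForm]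
  simp only [h2]

theorem linearForm_smul_right {V : Space d → ℝ} {Ω : ℝ} (hR : ControlsRotation V Ω) {φ v : L2 d}
    (c : ℂ) (hφ : φ ∈ energySpace V) (hv : v ∈ energySpace V) :
    linearForm V Ω φ (c • v) = conj c * linearForm V Ω φ v := by
  rw [← linearForm_conj hR hφ (energySpace_smul c hv), linearForm_smul_left hR c hv hφ, map_mul,
    linearForm_conj hR hφ hv]

theorem linearForm_add_right {V : Space d → ℝ} (hVm : AEMeasurable V volume)
    (hV0 : ∀ x, 0 ≤ V x) {Ω : ℝ} (hR : ControlsRotation V Ω) {φ v w : L2 d}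
    (hφ : φ ∈ energySpace V) (hv : v ∈ energySpace V) (hw : w ∈ energySpace V) :
    linearForm V Ω φ (v + w) = linearForm V Ω φ v + linearForm V Ω φ w := by
  rw [← linearForm_conj hR hφ (energySpace_add hVm hV0 hv hw),
    linearForm_add_left hVm hV0 hR hv hw hφ, map_add, linearForm_conj hR hφ hv,
    linearForm_conj hR hφ hw]

theorem linearEnergy_eq (V : Space d → ℝ) (Ω : ℝ) (φ : L2 d) :
    linearEnergy V Ω φ = staticEnergy V φ - (angularForm Ω φ φ).re := by
  have : ∫ x, conj (φ x) * angularMomentum φ x = ∫ x, angularMomentum φ x * conj (φ x) := by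
    simp only [mul_comm]
  rw [linearEnergy, staticEnergy, angularForm, Complex.re_ofReal_mul, this]

theorem linearEnergy_eq_re (V : Space d → ℝ) (Ω : ℝ) (φ : L2 d) :
    linearEnergy V Ω φ = (linearForm V Ω φ φ).re := by
  have h2 : ∀ i, ∫ x, weakPartial i φ x * conj (weakPartial i φ x)
      = ((‖weakPartial i φ‖ ^ 2 : ℝ) : ℂ) := fun i => by
    rw [integral_mul_conj_eq_inner, inner_self_eq_norm_sq_to_K]
    simp
  have h3 : ∫ x, (V x : ℂ) * φ x * conj (φ x) = ((∫ x, V x * ‖φ x‖ ^ 2 : ℝ) : ℂ) := by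
    rw [← integral_complex_ofReal]
    refine integral_congr_ae (.of_forall fun x => ?_)
    simp only [mul_assoc, Complex.mul_conj']
    push_cast
    ring
  have h4 : linearForm V Ω φ φ = ((staticEnergy V φ : ℝ) : ℂ) - angularForm Ω φ φ := by
    simp only [linearForm, h2, h3, staticEnergy, angularForm]
    push_cast
    ring
  rw [h4, Complex.sub_re, Complex.ofReal_re, linearEnergy_eq]

theorem linearEnergy_add {V : Space d → ℝ} (hVm : AEMeasurable V volume)
    (hV0 : ∀ x, 0 ≤ V x) {Ω : ℝ} (hR : ControlsRotation V Ω) {φ v : L2 d}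
    (hφ : φ ∈ energySpace V) (hv : v ∈ energySpace V) :
    linearEnergy V Ω (φ + v)
      = linearEnergy V Ω φ + 2 * (linearForm V Ω φ v).re + linearEnergy V Ω v := by
  simp only [linearEnergy_eq_re]
  rw [linearForm_add_left hVm hV0 hR hφ hv (energySpace_add hVm hV0 hφ hv),
    linearForm_add_right hVm hV0 hR hφ hφ hv, linearForm_add_right hVm hV0 hR hv hφ hv,
    ← linearForm_conj hR hv hφ]
  simp only [Complex.add_re, Complex.conj_re]
  ring

theorem linearEnergy_smul {V : Space d → ℝ} {Ω : ℝ} (hR : ControlsRotation V Ω) {φ : L2 d}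
    (c : ℂ) (hφ : φ ∈ energySpace V) :
    linearEnergy V Ω (c • φ) = ‖c‖ ^ 2 * linearEnergy V Ω φ := by
  simp only [linearEnergy_eq_re]
  rw [linearForm_smul_left hR c hφ (energySpace_smul c hφ), linearForm_smul_right hR c hφ hφ,
    ← mul_assoc, Complex.mul_conj', ← Complex.ofReal_pow, Complex.re_ofReal_mul]

theorem linearEnergy_parallelogram {V : Space d → ℝ} (hVm : AEMeasurable V volume)
    (hV0 : ∀ x, 0 ≤ V x) {Ω : ℝ} (hR : ControlsRotation V Ω) {φ v : L2 d}
    (hφ : φ ∈ energySpace V) (hv : v ∈ energySpace V) :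
    linearEnergy V Ω (φ + v) + linearEnergy V Ω (φ - v)
      = 2 * linearEnergy V Ω φ + 2 * linearEnergy V Ω v := by
  have e : φ - v = φ + (-1 : ℂ) • v := by rw [neg_one_smul, sub_eq_add_neg]
  rw [e, linearEnergy_add hVm hV0 hR hφ hv,
    linearEnergy_add hVm hV0 hR hφ (energySpace_smul _ hv), linearEnergy_smul hR _ hv,
    linearForm_smul_right hR _ hφ hv]
  simp
  ring

/-- The quadratic form is comparable to the static energy, up to multiples of the mass. -/
theorem exists_linearEnergy_bounds {V : Space d → ℝ} (hV0 : ∀ x, 0 ≤ V x) {Ω : ℝ}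
    (hR : ControlsRotation V Ω) : ∃ a C : ℝ, 0 < a ∧ 0 ≤ C ∧ ∀ φ ∈ energySpace V,
      a * staticEnergy V φ - C * ‖φ‖ ^ 2 ≤ linearEnergy V Ω φ ∧
      linearEnergy V Ω φ ≤ 2 * staticEnergy V φ + C * ‖φ‖ ^ 2 := by
  obtain ⟨θ, C, hθ0, hθ1, hC, hb⟩ := exists_angularForm_bound hR
  refine ⟨1 - θ, C, by linarith, hC, fun φ hφ => ?_⟩
  have h1 := (Complex.abs_re_le_norm _).trans (hb φ hφ)
  change _ ≤ θ * staticEnergy V φ + _ at h1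
  have h2 := abs_le.1 h1
  have h3 := staticEnergy_nonneg hV0 φ
  rw [linearEnergy_eq]
  constructor
  · linarith [h2.2]
  · nlinarith [h2.1]

/-! ### The nonlinear term and lower bounds for the action -/

theorem integrable_nonlinear {p : ℝ} (hp : 1 < p)
    (hpd : 3 ≤ d → p < ((d : ℝ) + 2) / ((d : ℝ) - 2)) {V : Space d → ℝ} {φ : L2 d}
    (hφ : φ ∈ energySpace V) : Integrable fun x => ‖φ x‖ ^ (p + 1) :=
  integrable_norm_rpow (hasWeakPartial_weakPartial hφ) hp hpd

theorem integral_norm_rpow_smul (p : ℝ) (c : ℂ) (φ : L2 d) :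
    ∫ x, ‖(c • φ : L2 d) x‖ ^ (p + 1) = ‖c‖ ^ (p + 1) * ∫ x, ‖φ x‖ ^ (p + 1) := by
  rw [← integral_const_mul]
  refine integral_congr_ae ?_
  filter_upwards [Lp.coeFn_smul c φ] with x hx
  rw [hx, Pi.smul_apply, norm_smul, Real.mul_rpow (norm_nonneg _) (norm_nonneg _)]

/-- Midpoint convexity of the nonlinear term. -/
theorem integral_norm_rpow_midpoint {p : ℝ} (hp : 1 < p) {φ ψ : L2 d}
    (hφ : Integrable fun x => ‖φ x‖ ^ (p + 1)) (hψ : Integrable fun x => ‖ψ x‖ ^ (p + 1)) :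
    ∫ x, ‖((1 / 2 : ℂ) • (φ + ψ) : L2 d) x‖ ^ (p + 1)
      ≤ 1 / 2 * (∫ x, ‖φ x‖ ^ (p + 1)) + 1 / 2 * ∫ x, ‖ψ x‖ ^ (p + 1) := by
  rw [← integral_const_mul, ← integral_const_mul,
    ← integral_add (hφ.const_mul _) (hψ.const_mul _)]
  refine integral_mono_of_nonneg (.of_forall fun x => by positivity)
    ((hφ.const_mul _).add (hψ.const_mul _)) ?_
  filter_upwards [Lp.coeFn_smul (1 / 2 : ℂ) (φ + ψ), Lp.coeFn_add φ ψ] with x h1 h2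
  rw [h1, Pi.smul_apply, h2, Pi.add_apply, norm_smul]
  have h3 : ‖(1 / 2 : ℂ)‖ * ‖φ x + ψ x‖ ≤ 1 / 2 * ‖φ x‖ + 1 / 2 * ‖ψ x‖ := by
    have := norm_add_le (φ x) (ψ x)
    norm_num
    linarith
  refine (Real.rpow_le_rpow (by positivity) h3 (by linarith)).trans ?_
  have := (convexOn_rpow (by linarith : 1 ≤ p + 1)).2 (Set.mem_Ici.2 (norm_nonneg (φ x)))
    (Set.mem_Ici.2 (norm_nonneg (ψ x))) (by norm_num : (0 : ℝ) ≤ 1 / 2)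
    (by norm_num : (0 : ℝ) ≤ 1 / 2) (by norm_num)
  simpa only [smul_eq_mul] using this

/-- The mass is dominated by any multiple of the potential energy (outside of a compact set) and
of the nonlinear term (inside), up to a constant. -/
theorem exists_mass_le {p : ℝ} (hp : 1 < p)
    (hpd : 3 ≤ d → p < ((d : ℝ) + 2) / ((d : ℝ) - 2)) {V : Space d → ℝ} (hV0 : ∀ x, 0 ≤ V x)
    (hV : Tendsto V (cocompact (Space d)) atTop) {κ b : ℝ} (hκ : 0 < κ) (hb : 0 < b) {K : ℝ}
    (hK : 0 ≤ K) : ∃ C : ℝ, ∀ φ ∈ energySpace V,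
      K * ‖φ‖ ^ 2 - C ≤ κ * (∫ x, V x * ‖φ x‖ ^ 2) + b * ∫ x, ‖φ x‖ ^ (p + 1) := by
  obtain ⟨S, hS, hSc⟩ := mem_cocompact.1 (hV.eventually_ge_atTop (K / κ))
  have hSm : MeasurableSet S := hS.isClosed.measurableSet
  set T : ℝ := (K / b) ^ (1 / (p - 1))
  have hT0 : 0 ≤ T := by positivity
  have hpt : ∀ t : ℝ, 0 ≤ t → K * t ^ 2 ≤ b * t ^ (p + 1) + K * T ^ 2 := by
    intro t ht
    have ht1 : 0 ≤ b * t ^ (p + 1) := by positivity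
    rcases le_or_gt t T with h | h
    · have : K * t ^ 2 ≤ K * T ^ 2 := by gcongr
      linarith
    · have ht0 : 0 < t := hT0.trans_lt h
      have h1 : K / b ≤ t ^ (p - 1) := by
        have h2 : T ^ (p - 1) ≤ t ^ (p - 1) := Real.rpow_le_rpow hT0 h.le (by linarith)
        rwa [← Real.rpow_mul (by positivity), one_div_mul_cancel (by linarith),
          Real.rpow_one] at h2
      have h3 : t ^ (p + 1) = t ^ (p - 1) * t ^ 2 := by
        rw [← Real.rpow_natCast t 2, ← Real.rpow_add ht0]
        congr 1
        push_cast
        ring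
      rw [div_le_iff₀ hb] at h1
      have h4 := mul_le_mul_of_nonneg_right h1 (sq_nonneg t)
      rw [h3]
      nlinarith [mul_nonneg hK (sq_nonneg T)]
  refine ⟨K * T ^ 2 * volume.real S, fun φ hφ => ?_⟩
  have i1 := hφ.2.const_mul κ
  have i2 := (integrable_nonlinear hp hpd hφ).const_mul b
  have i12 : Integrable fun x => κ * (V x * ‖φ x‖ ^ 2) + b * ‖φ x‖ ^ (p + 1) := i1.add i2
  have i3 : Integrable (S.indicator fun _ => K * T ^ 2) (volume : Measure (Space d)) :=
    (integrable_indicator_iff hSm).2 (integrableOn_const hS.measure_lt_top.ne)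
  have h3 : ∫ x, S.indicator (fun _ => K * T ^ 2) x = K * T ^ 2 * volume.real S := by
    rw [integral_indicator hSm, setIntegral_const, smul_eq_mul, mul_comm]
  rw [sub_le_iff_le_add, norm_sq_eq_integral, ← h3, ← integral_const_mul, ← integral_const_mul,
    ← integral_const_mul, ← integral_add i1 i2, ← integral_add i12 i3]
  refine integral_mono ((integrable_norm_sq φ).const_mul K) (i12.add i3) fun x => ?_
  have hn := norm_nonneg (φ x)
  by_cases hx : x ∈ S
  · have := hpt _ hn
    have h0 : 0 ≤ κ * (V x * ‖φ x‖ ^ 2) := by have := hV0 x; positivity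
    simp only [Set.indicator_of_mem hx]
    linarith
  · have h1 : K / κ ≤ V x := hSc hx
    rw [div_le_iff₀ hκ] at h1
    have h0 : 0 ≤ b * ‖φ x‖ ^ (p + 1) := by positivity
    simp only [Set.indicator_of_notMem hx]
    nlinarith [mul_le_mul_of_nonneg_right h1 (sq_nonneg ‖φ x‖)]

/-- The action is coercive on the energy space, for every `ω`. -/
theorem exists_action_lower_bound {p : ℝ} (hp : 1 < p)
    (hpd : 3 ≤ d → p < ((d : ℝ) + 2) / ((d : ℝ) - 2)) {V : Space d → ℝ} (hV0 : ∀ x, 0 ≤ V x)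
    (hV : Tendsto V (cocompact (Space d)) atTop) {β : ℝ} (hβ : 0 < β) {Ω : ℝ}
    (hR : ControlsRotation V Ω) (ω : ℝ) : ∃ a C : ℝ, 0 < a ∧ ∀ φ ∈ energySpace V,
      a * staticEnergy V φ + ‖φ‖ ^ 2 - C ≤ action p V β Ω ω φ := by
  obtain ⟨a, C, ha, hC, hb⟩ := exists_linearEnergy_bounds hV0 hR
  obtain ⟨C', hC'⟩ := exists_mass_le hp hpd hV0 hV (κ := a / 2) (b := 2 * β / (p + 1))
    (by positivity) (by positivity) (K := C + 1 + |ω|) (by positivity)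
  refine ⟨a / 2, C', by positivity, fun φ hφ => ?_⟩
  have h1 := (hb φ hφ).1
  have h2 := hC' φ hφ
  have h3 : -|ω| * ‖φ‖ ^ 2 ≤ ω * ‖φ‖ ^ 2 :=
    mul_le_mul_of_nonneg_right (neg_abs_le ω) (sq_nonneg _)
  have h4 : (∫ x, V x * ‖φ x‖ ^ 2) ≤ staticEnergy V φ := by
    rw [staticEnergy]
    have : 0 ≤ 1 / 2 * (∑ i, ‖weakPartial i φ‖ ^ 2) := by positivity
    linarith
  rw [action, energy]
  nlinarith

/-! ### Existence of minimizers -/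

/-- Fatou's lemma for Bochner integrals, with bounds that converge. -/
theorem integral_le_of_tendsto_ae {F : ℕ → Space d → ℝ} {G : Space d → ℝ} {b : ℕ → ℝ} {c : ℝ}
    (hF : ∀ n, Integrable (F n)) (hF0 : ∀ n x, 0 ≤ F n x)
    (hlim : ∀ᵐ x, Tendsto (fun n => F n x) atTop (𝓝 (G x)))
    (hb : ∀ n, ∫ x, F n x ≤ b n) (hbc : Tendsto b atTop (𝓝 c)) :
    Integrable G ∧ ∫ x, G x ≤ c := by
  have hG0 : ∀ᵐ x, 0 ≤ G x := by
    filter_upwards [hlim] with x hx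
    exact ge_of_tendsto' hx fun n => hF0 n x
  have hGm : AEStronglyMeasurable G volume :=
    aestronglyMeasurable_of_tendsto_ae atTop (fun n => (hF n).1) hlim
  have hc : 0 ≤ c := ge_of_tendsto' hbc fun n => (integral_nonneg (hF0 n)).trans (hb n)
  have key : ∫⁻ x, ENNReal.ofReal (G x) ≤ ENNReal.ofReal c := by
    calc ∫⁻ x, ENNReal.ofReal (G x)
        = ∫⁻ x, liminf (fun n => ENNReal.ofReal (F n x)) atTop := by
          refine lintegral_congr_ae ?_
          filter_upwards [hlim] with x hx
          exact ((ENNReal.continuous_ofReal.tendsto _).comp hx).liminf_eq.symm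
      _ ≤ liminf (fun n => ∫⁻ x, ENNReal.ofReal (F n x)) atTop :=
          lintegral_liminf_le' fun n => (hF n).1.aemeasurable.ennreal_ofReal
      _ ≤ liminf (fun n => ENNReal.ofReal (b n)) atTop := by
          refine liminf_le_liminf (.of_forall fun n => ?_)
          rw [← ofReal_integral_eq_lintegral_ofReal (hF n) (.of_forall (hF0 n))]
          exact ENNReal.ofReal_le_ofReal (hb n)
      _ = ENNReal.ofReal c := ((ENNReal.continuous_ofReal.tendsto _).comp hbc).liminf_eq
  have hint : Integrable G :=
    ⟨hGm, (hasFiniteIntegral_iff_ofReal hG0).2 (key.trans_lt ENNReal.ofReal_lt_top)⟩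
  refine ⟨hint, ?_⟩
  rw [← ofReal_integral_eq_lintegral_ofReal hint hG0] at key
  exact (ENNReal.ofReal_le_ofReal_iff hc).1 key

/-- Convergence in `L²` implies convergence almost everywhere along a subsequence. -/
theorem exists_subseq_ae_tendsto {f : ℕ → L2 d} {u : L2 d} (h : Tendsto f atTop (𝓝 u)) :
    ∃ θ : ℕ → ℕ, StrictMono θ ∧ ∀ᵐ x, Tendsto (fun n => f (θ n) x) atTop (𝓝 (u x)) :=
  (tendstoInMeasure_of_tendsto_Lp h).exists_seq_tendsto_ae

/-- Sequences in the energy space with bounded energy are precompact in `L²`. -/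
theorem exists_subseq_tendsto_of_staticEnergy_le {V : Space d → ℝ} (hV0 : ∀ x, 0 ≤ V x)
    (hV : Tendsto V (cocompact (Space d)) atTop) {f : ℕ → L2 d} (hf : ∀ n, f n ∈ energySpace V)
    {B : ℝ} (hB : ∀ n, staticEnergy V (f n) + ‖f n‖ ^ 2 ≤ B) :
    ∃ (θ : ℕ → ℕ) (u : L2 d), StrictMono θ ∧ Tendsto (f ∘ θ) atTop (𝓝 u) := by
  have hP : ∀ n, 0 ≤ ∫ x, V x * ‖f n x‖ ^ 2 := fun n =>
    integral_nonneg fun x => mul_nonneg (hV0 x) (sq_nonneg _)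
  have hB0 : 0 ≤ B := (add_nonneg (staticEnergy_nonneg hV0 (f 0)) (sq_nonneg _)).trans (hB 0)
  refine exists_subseq_tendsto (g := fun n i => weakPartial i (f n))
    (fun n i => hasWeakPartial_weakPartial (hf n) i) (B := 2 * B) (fun n => ?_) fun ε hε => ?_
  · have h1 := hB n
    rw [staticEnergy] at h1
    rw [sobolevEnergy]
    nlinarith [hP n, sq_nonneg ‖f n‖]
  · set K : ℝ := (B + 1) / ε ^ 2
    have hK0 : 0 < K := by positivity
    obtain ⟨S, hS, hSc⟩ := mem_cocompact.1 (hV.eventually_ge_atTop K)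
    obtain ⟨R, hR⟩ := hS.isBounded.subset_closedBall 0
    refine ⟨R, fun n => ?_⟩
    refine (pow_le_pow_iff_left₀ (norm_nonneg _) hε.le two_ne_zero).1 ?_
    rw [norm_restrictTo_sq]
    have h1 : K * ∫ x in (Metric.closedBall 0 R)ᶜ, ‖f n x‖ ^ 2 ≤ ∫ x, V x * ‖f n x‖ ^ 2 := by
      rw [← integral_const_mul]
      refine le_trans (setIntegral_mono_on ((integrable_norm_sq _).const_mul _).integrableOn
        (hf n).2.integrableOn (measurableSet_closedBall_zero R).compl fun x hx => ?_)
        (setIntegral_le_integral (hf n).2 (.of_forall fun x => mul_nonneg (hV0 x) (sq_nonneg _)))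
      have : K ≤ V x := hSc fun hxS => hx (hR hxS)
      gcongr
    have h2 : (∫ x, V x * ‖f n x‖ ^ 2) ≤ B := by
      have h3 := hB n
      rw [staticEnergy] at h3
      have : 0 ≤ 1 / 2 * (∑ i, ‖weakPartial i (f n)‖ ^ 2) := by positivity
      linarith [sq_nonneg ‖f n‖]
    have h4 : K * ε ^ 2 = B + 1 := by simp only [K]; field_simp
    refine le_of_mul_le_mul_left ?_ hK0
    linarith

/-- The energy space is complete: an `L²`-convergent sequence that is Cauchy for the static
energy converges in the static energy. -/
theorem tendsto_staticEnergy_sub {V : Space d → ℝ} (hVm : AEMeasurable V volume)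
    (hV0 : ∀ x, 0 ≤ V x) {f : ℕ → L2 d} (hf : ∀ n, f n ∈ energySpace V) {u : L2 d}
    (hu : Tendsto f atTop (𝓝 u))
    (hc : ∀ ε > 0, ∃ N, ∀ m ≥ N, ∀ n ≥ N, staticEnergy V (f m - f n) ≤ ε) :
    u ∈ energySpace V ∧ Tendsto (fun n => staticEnergy V (f n - u)) atTop (𝓝 0) := by
  have hkin : ∀ i m n, ‖weakPartial i (f m) - weakPartial i (f n)‖ ^ 2
      ≤ 2 * staticEnergy V (f m - f n) := by
    intro i m n
    rw [← weakPartial_sub (hf m) (hf n), staticEnergy]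
    have h1 := Finset.single_le_sum (f := fun i => ‖weakPartial i (f m - f n)‖ ^ 2)
      (fun i _ => by positivity) (Finset.mem_univ i)
    have h2 : 0 ≤ ∫ x, V x * ‖(f m - f n : L2 d) x‖ ^ 2 :=
      integral_nonneg fun x => mul_nonneg (hV0 x) (sq_nonneg _)
    linarith
  have hpot : ∀ m n, ∫ x, V x * ‖(f m - f n : L2 d) x‖ ^ 2 ≤ staticEnergy V (f m - f n) := by
    intro m n
    rw [staticEnergy]
    have : 0 ≤ 1 / 2 * (∑ i, ‖weakPartial i (f m - f n)‖ ^ 2) := by positivity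
    linarith
  have hcd : ∀ i, CauchySeq fun n => weakPartial i (f n) := by
    intro i
    refine Metric.cauchySeq_iff.2 fun ε hε => ?_
    obtain ⟨N, hN⟩ := hc (ε ^ 2 / 4) (by positivity)
    refine ⟨N, fun m hm n hn => ?_⟩
    rw [dist_eq_norm]
    refine (pow_lt_pow_iff_left₀ (norm_nonneg _) hε.le two_ne_zero).1 ?_
    have h1 := hkin i m n
    have h2 := hN m hm n hn
    have : 0 < ε ^ 2 := by positivity
    linarith
  choose g hg using fun i => cauchySeq_tendsto_of_complete (hcd i)
  have hug : ∀ i, HasWeakPartial i u (g i) := fun i =>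
    HasWeakPartial.of_tendsto (fun n => hasWeakPartial_weakPartial (hf n) i) hu (hg i)
  obtain ⟨θ, hθ, hae⟩ := exists_subseq_ae_tendsto hu
  have hpotlim : ∀ ε > 0, ∃ N, ∀ n ≥ N, Integrable (fun x => V x * ‖(f n - u : L2 d) x‖ ^ 2) ∧
      ∫ x, V x * ‖(f n - u : L2 d) x‖ ^ 2 ≤ ε := by
    intro ε hε
    obtain ⟨N, hN⟩ := hc ε hε
    refine ⟨N, fun n hn => ?_⟩
    refine integral_le_of_tendsto_ae (F := fun m x => V x * ‖(f n - f (θ (m + N)) : L2 d) x‖ ^ 2)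
      (b := fun _ => ε) (fun m => (energySpace_sub hVm hV0 (hf _) (hf _)).2)
      (fun m x => mul_nonneg (hV0 x) (sq_nonneg _)) ?_ (fun m => ?_) tendsto_const_nhds
    · have h1 := ae_all_iff.2 fun m => Lp.coeFn_sub (f n) (f (θ (m + N)))
      filter_upwards [hae, h1, Lp.coeFn_sub (f n) u] with x hx h1 h2
      simp only [h1, h2, Pi.sub_apply]
      exact (((hx.comp (tendsto_add_atTop_nat N)).const_sub (f n x)).norm.pow 2).const_mul (V x)
    · have h2 : N ≤ θ (m + N) := (Nat.le_add_left N m).trans (hθ.id_le (m + N))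
      exact (hpot _ _).trans (hN n hn _ h2)
  have hsub : ∀ n i, HasWeakPartial i (f n - u) (weakPartial i (f n) - g i) := by
    intro n i
    have := (hasWeakPartial_weakPartial (hf n) i).add ((hug i).smul (-1))
    rwa [neg_one_smul, neg_one_smul, ← sub_eq_add_neg, ← sub_eq_add_neg] at this
  have huX : u ∈ energySpace V := by
    obtain ⟨N, hN⟩ := hpotlim 1 one_pos
    have h1 : f N - u ∈ energySpace V := ⟨fun i => ⟨_, hsub N i⟩, (hN N le_rfl).1⟩
    have h2 := energySpace_sub hVm hV0 (hf N) h1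
    rwa [sub_sub_cancel] at h2
  refine ⟨huX, ?_⟩
  have t1 : Tendsto (fun n => ∑ i, ‖weakPartial i (f n - u)‖ ^ 2) atTop (𝓝 0) := by
    have : Tendsto (fun n => ∑ i, ‖weakPartial i (f n) - g i‖ ^ 2) atTop
        (𝓝 (∑ i : Fin d, ‖g i - g i‖ ^ 2)) :=
      tendsto_finsetSum _ fun i _ => ((hg i).sub_const (g i)).norm.pow 2
    simp only [sub_self, norm_zero, ne_eq, OfNat.ofNat_ne_zero, not_false_eq_true, zero_pow,
      Finset.sum_const_zero] at this
    exact this.congr fun n => by simp only [weakPartial_eq (hsub n _)]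
  have t2 : Tendsto (fun n => ∫ x, V x * ‖(f n - u : L2 d) x‖ ^ 2) atTop (𝓝 0) := by
    refine Metric.tendsto_atTop.2 fun ε hε => ?_
    obtain ⟨N, hN⟩ := hpotlim (ε / 2) (by positivity)
    refine ⟨N, fun n hn => ?_⟩
    rw [Real.dist_0_eq_abs, abs_of_nonneg (integral_nonneg fun x =>
      mul_nonneg (hV0 x) (sq_nonneg _))]
    linarith [(hN n hn).2]
  simpa only [staticEnergy, mul_zero, add_zero] using (t1.const_mul (1 / 2)).add t2

/-- The quadratic form is continuous with respect to the static energy and the mass. -/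
theorem tendsto_linearEnergy {V : Space d → ℝ} (hVm : AEMeasurable V volume)
    (hV0 : ∀ x, 0 ≤ V x) {Ω : ℝ} (hR : ControlsRotation V Ω) {f : ℕ → L2 d}
    (hf : ∀ n, f n ∈ energySpace V) {u : L2 d} (huX : u ∈ energySpace V)
    (hu : Tendsto f atTop (𝓝 u))
    (hE : Tendsto (fun n => staticEnergy V (f n - u)) atTop (𝓝 0)) :
    Tendsto (fun n => linearEnergy V Ω (f n)) atTop (𝓝 (linearEnergy V Ω u)) := by
  obtain ⟨a, C, ha, hC, hb⟩ := exists_linearEnergy_bounds hV0 hR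
  set h : ℕ → L2 d := fun n => f n - u
  have hh : ∀ n, h n ∈ energySpace V := fun n => energySpace_sub hVm hV0 (hf n) huX
  set y : ℕ → ℝ := fun n => 2 * staticEnergy V (h n) + 2 * C * ‖h n‖ ^ 2
  have hy : Tendsto y atTop (𝓝 0) := by
    have h1 : Tendsto (fun n => ‖h n‖ ^ 2) atTop (𝓝 0) := by
      have := ((hu.sub_const u).norm.pow 2)
      simpa using this
    simpa using (hE.const_mul 2).add (h1.const_mul (2 * C))
  have hy0 : ∀ n, 0 ≤ y n := fun n => by
    have := staticEnergy_nonneg hV0 (h n)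
    positivity
  have hLh : Tendsto (fun n => linearEnergy V Ω (h n)) atTop (𝓝 0) := by
    refine squeeze_zero_norm (fun n => ?_) hy
    have h1 := hb (h n) (hh n)
    have h2 := mul_nonneg ha.le (staticEnergy_nonneg hV0 (h n))
    have h3 := staticEnergy_nonneg hV0 (h n)
    have h4 := mul_nonneg hC (sq_nonneg ‖h n‖)
    rw [Real.norm_eq_abs, abs_le]
    simp only [y]
    constructor <;> linarith [h1.1, h1.2]
  -- `A` and `y n` bound the nonnegative form `L + C ‖·‖²` at `u` and at `h n`
  set A : ℝ := 2 * staticEnergy V u + 2 * C * ‖u‖ ^ 2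
  have hA0 : 0 ≤ A := by
    have := staticEnergy_nonneg hV0 u
    positivity
  set re : ℕ → ℝ := fun n => 2 * (linearForm V Ω u (h n)).re
  have hpos : ∀ v ∈ energySpace V, 0 ≤ linearEnergy V Ω v + C * ‖v‖ ^ 2 := fun v hv => by
    have := (hb v hv).1
    have := mul_nonneg ha.le (staticEnergy_nonneg hV0 v)
    linarith
  have hup : ∀ v ∈ energySpace V,
      linearEnergy V Ω v + C * ‖v‖ ^ 2 ≤ 2 * staticEnergy V v + 2 * C * ‖v‖ ^ 2 := fun v hv => by
    have := (hb v hv).2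
    linarith
  have hnsq : ∀ v w : L2 d, ‖v + w‖ ^ 2 = ‖v‖ ^ 2 + 2 * (inner ℂ v w : ℂ).re + ‖w‖ ^ 2 :=
    fun v w => norm_add_sq (𝕜 := ℂ) v w
  have hin : Tendsto (fun n => 2 * C * (inner ℂ u (h n) : ℂ).re) atTop (𝓝 0) := by
    have h1 : Tendsto h atTop (𝓝 0) := by simpa using hu.sub_const u
    have h2 : Tendsto (fun n => (inner ℂ u (h n) : ℂ)) atTop (𝓝 0) := by
      simpa using (tendsto_const_nhds (x := u)).inner (𝕜 := ℂ) h1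
    have h3 := (Complex.continuous_re.tendsto 0).comp h2
    simpa using h3.const_mul (2 * C)
  have hexp : ∀ (s : ℝ) (n : ℕ), 0 ≤ A + s * (re n + 2 * C * (inner ℂ u (h n) : ℂ).re)
      + s ^ 2 * y n := by
    intro s n
    have hsX := energySpace_smul (s : ℂ) (hh n)
    have h1 := hpos _ (energySpace_add hVm hV0 huX hsX)
    rw [linearEnergy_add hVm hV0 hR huX hsX, linearEnergy_smul hR _ (hh n),
      linearForm_smul_right hR _ huX (hh n), hnsq, inner_smul_right, norm_smul, mul_pow,
      Complex.conj_ofReal, Complex.re_ofReal_mul, Complex.re_ofReal_mul, Complex.norm_real,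
      Real.norm_eq_abs, sq_abs] at h1
    have h2 := hup u huX
    have h3 := mul_le_mul_of_nonneg_left (hup (h n) (hh n)) (sq_nonneg s)
    simp only [A, y, re]
    nlinarith
  have hz : Tendsto (fun n => re n + 2 * C * (inner ℂ u (h n) : ℂ).re) atTop (𝓝 0) := by
    refine Metric.tendsto_atTop.2 fun ε hε => ?_
    set s : ℝ := 2 * (A + 1) / ε
    have hs : 0 < s := by positivity
    obtain ⟨N, hN⟩ := Metric.tendsto_atTop.1 hy (ε / (2 * s)) (by positivity)
    refine ⟨N, fun n hn => ?_⟩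
    have h1 := hN n hn
    rw [Real.dist_0_eq_abs, abs_of_nonneg (hy0 n), lt_div_iff₀ (by positivity)] at h1
    have h2 := hexp s n
    have h3 := hexp (-s) n
    set z := re n + 2 * C * (inner ℂ u (h n) : ℂ).re
    have h4 : s * ε = 2 * (A + 1) := by simp only [s]; field_simp
    have h5 : s ^ 2 * y n < s * ε / 2 := by nlinarith
    rw [Real.dist_0_eq_abs, abs_lt]
    constructor
    · refine lt_of_mul_lt_mul_left ?_ hs.le
      linarith
    · refine lt_of_mul_lt_mul_left ?_ hs.le
      linarith
  have hre : Tendsto re atTop (𝓝 0) := by simpa using hz.sub hin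
  have hfin : ∀ n, linearEnergy V Ω (f n) = linearEnergy V Ω u + re n + linearEnergy V Ω (h n) := by
    intro n
    rw [← linearEnergy_add hVm hV0 hR huX (hh n)]
    simp [h]
  simp only [hfin]
  simpa using (hre.const_add (linearEnergy V Ω u)).add hLh

/-- The action is midpoint convex, with the usual gain, up to the defect of the mass. -/
theorem action_midpoint_le {p : ℝ} (hp : 1 < p)
    (hpd : 3 ≤ d → p < ((d : ℝ) + 2) / ((d : ℝ) - 2)) {V : Space d → ℝ}
    (hVm : AEMeasurable V volume) (hV0 : ∀ x, 0 ≤ V x) {β : ℝ} (hβ : 0 < β) {Ω : ℝ}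
    (hR : ControlsRotation V Ω) (ω : ℝ) {φ ψ : L2 d} (hφ : φ ∈ energySpace V)
    (hψ : ψ ∈ energySpace V) :
    action p V β Ω ω ((1 / 2 : ℂ) • (φ + ψ)) ≤ 1 / 2 * action p V β Ω ω φ
      + 1 / 2 * action p V β Ω ω ψ
      - 1 / 4 * (linearEnergy V Ω (φ - ψ) + ω * ‖φ - ψ‖ ^ 2) := by
  have h1 := linearEnergy_parallelogram hVm hV0 hR hφ hψ
  have h2 := parallelogram_law_with_norm ℂ φ ψ
  have h3 := integral_norm_rpow_midpoint hp (integrable_nonlinear hp hpd hφ)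
    (integrable_nonlinear hp hpd hψ)
  have h4 : ‖(1 / 2 : ℂ)‖ = 1 / 2 := by norm_num
  have h5 := mul_le_mul_of_nonneg_left h3 (by positivity : 0 ≤ 2 * β / (p + 1))
  rw [action, energy, linearEnergy_smul hR _ (energySpace_add hVm hV0 hφ hψ), norm_smul, h4,
    action, energy, action, energy]
  have h6 : ω * (‖φ + ψ‖ ^ 2 + ‖φ - ψ‖ ^ 2) = ω * (2 * (‖φ‖ ^ 2 + ‖ψ‖ ^ 2)) := by
    rw [h2]
  nlinarith

/-- The action attains its minimum on the energy space. A minimizing sequence is precompact in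
`L²`; convexity of the remaining terms then makes it converge in the energy space. -/
theorem exists_minimizer {p : ℝ} (hp : 1 < p)
    (hpd : 3 ≤ d → p < ((d : ℝ) + 2) / ((d : ℝ) - 2)) {V : Space d → ℝ}
    (hVm : AEMeasurable V volume) (hV0 : ∀ x, 0 ≤ V x)
    (hV : Tendsto V (cocompact (Space d)) atTop) {β : ℝ} (hβ : 0 < β) {Ω : ℝ}
    (hR : ControlsRotation V Ω) (ω : ℝ) (hne : (energySpace V).Nonempty) :
    ∃ u ∈ energySpace V, ∀ χ ∈ energySpace V, action p V β Ω ω u ≤ action p V β Ω ω χ := by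
  obtain ⟨a, C, ha, hlow⟩ := exists_action_lower_bound hp hpd hV0 hV hβ hR ω
  set S := action p V β Ω ω
  set s := sInf (S '' energySpace V)
  have hbdd : BddBelow (S '' energySpace V) := by
    refine ⟨-C, ?_⟩
    rintro _ ⟨φ, hφ, rfl⟩
    have h1 := hlow φ hφ
    have h2 := mul_nonneg ha.le (staticEnergy_nonneg hV0 φ)
    have h3 := sq_nonneg ‖φ‖
    linarith
  have hs : ∀ φ ∈ energySpace V, s ≤ S φ := fun φ hφ => csInf_le hbdd (Set.mem_image_of_mem _ hφ)
  obtain ⟨b, -, hb, hbmem⟩ := exists_seq_tendsto_sInf (hne.image S) hbdd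
  choose f hfX hfb using hbmem
  have hfS : Tendsto (fun n => S (f n)) atTop (𝓝 s) := by simpa only [hfb] using hb
  obtain ⟨B, hB⟩ := hfS.bddAbove_range
  have hfB : ∀ n, S (f n) ≤ B := fun n => hB (Set.mem_range_self n)
  obtain ⟨θ, u, hθ, hu⟩ := exists_subseq_tendsto_of_staticEnergy_le hV0 hV hfX
    (B := (B + C) / a + (B + C)) fun n => by
      have h1 := hlow _ (hfX n)
      have h2 := hfB n
      have h3 := mul_nonneg ha.le (staticEnergy_nonneg hV0 (f n))
      have h4 := sq_nonneg ‖f n‖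
      have h5 : staticEnergy V (f n) ≤ (B + C) / a := by
        rw [le_div_iff₀ ha]; linarith
      linarith
  set v : ℕ → L2 d := f ∘ θ
  have hvX : ∀ n, v n ∈ energySpace V := fun n => hfX _
  have hvS : Tendsto (fun n => S (v n)) atTop (𝓝 s) := hfS.comp hθ.tendsto_atTop
  obtain ⟨a', C', ha', hC', hb'⟩ := exists_linearEnergy_bounds hV0 hR
  have hcauchy : ∀ ε > 0, ∃ N, ∀ m ≥ N, ∀ n ≥ N, staticEnergy V (v m - v n) ≤ ε := by
    intro ε hε
    obtain ⟨N₁, hN₁⟩ := Metric.tendsto_atTop.1 hvS (a' * ε / 8) (by positivity)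
    obtain ⟨N₂, hN₂⟩ := Metric.cauchySeq_iff.1 hu.cauchySeq
      (Real.sqrt (a' * ε / (2 * (C' + |ω| + 1)))) (Real.sqrt_pos.2 (by positivity))
    refine ⟨max N₁ N₂, fun m hm n hn => ?_⟩
    have h1 := (abs_lt.1 (hN₁ m (le_of_max_le_left hm))).2
    have h2 := (abs_lt.1 (hN₁ n (le_of_max_le_left hn))).2
    have h3 := hN₂ m (le_of_max_le_right hm) n (le_of_max_le_right hn)
    rw [dist_eq_norm, Real.lt_sqrt (norm_nonneg _), lt_div_iff₀ (by positivity)] at h3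
    have h4 := action_midpoint_le hp hpd hVm hV0 hβ hR ω (hvX m) (hvX n)
    have h5 := hs _ (energySpace_smul (1 / 2 : ℂ) (energySpace_add hVm hV0 (hvX m) (hvX n)))
    have h6 := (hb' _ (energySpace_sub hVm hV0 (hvX m) (hvX n))).1
    have h7 : -|ω| * ‖v m - v n‖ ^ 2 ≤ ω * ‖v m - v n‖ ^ 2 :=
      mul_le_mul_of_nonneg_right (neg_abs_le ω) (sq_nonneg _)
    have h8 := sq_nonneg ‖v m - v n‖
    refine le_of_mul_le_mul_left ?_ ha'
    change S ((1 / 2 : ℂ) • (v m + v n)) ≤ 1 / 2 * S (v m) + 1 / 2 * S (v n) - _ at h4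
    change ‖v m - v n‖ ^ 2 * _ < _ at h3
    nlinarith
  obtain ⟨huX, hE⟩ := tendsto_staticEnergy_sub hVm hV0 hvX hu hcauchy
  have hL := tendsto_linearEnergy hVm hV0 hR hvX huX hu hE
  have hM : Tendsto (fun n => ω * ‖v n‖ ^ 2) atTop (𝓝 (ω * ‖u‖ ^ 2)) :=
    (hu.norm.pow 2).const_mul ω
  have hc0 : 0 < 2 * β / (p + 1) := by positivity
  have hN : Tendsto (fun n => ∫ x, ‖v n x‖ ^ (p + 1)) atTop
      (𝓝 ((s - linearEnergy V Ω u - ω * ‖u‖ ^ 2) / (2 * β / (p + 1)))) := by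
    refine (((hvS.sub hL).sub hM).div_const (2 * β / (p + 1))).congr fun n => ?_
    simp only [S, action, energy]
    field_simp
    ring
  obtain ⟨θ', hθ', hae⟩ := exists_subseq_ae_tendsto hu
  have hfat := (integral_le_of_tendsto_ae (F := fun n x => ‖v (θ' n) x‖ ^ (p + 1))
    (G := fun x => ‖u x‖ ^ (p + 1)) (fun n => integrable_nonlinear hp hpd (hvX _))
    (fun n x => by positivity) (by
      filter_upwards [hae] with x hx
      exact hx.norm.rpow_const (.inr (by linarith)))
    (fun n => le_rfl) (hN.comp hθ'.tendsto_atTop)).2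
  refine ⟨u, huX, fun χ hχ => le_trans ?_ (hs χ hχ)⟩
  rw [le_div_iff₀ hc0] at hfat
  simp only [S, action, energy]
  linarith

/-! ### The stationary equation -/

/-- The derivative of `z ↦ |z| ^ (p + 1)` along a line. -/
theorem hasDerivAt_norm_rpow_line {p : ℝ} (hp : 1 < p) (z w : ℂ) (t : ℝ) :
    HasDerivAt (fun t : ℝ => ‖z + (t : ℂ) * w‖ ^ (p + 1))
      ((p + 1) * ‖z + (t : ℂ) * w‖ ^ (p - 1) * ((z + (t : ℂ) * w) * conj w).re) t := by
  have h1 : HasDerivAt (fun t : ℝ => z + (t : ℂ) * w) w t := by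
    have := ((Complex.ofRealCLM.hasDerivAt (x := t)).mul_const w).const_add z
    simpa using this
  have h2 := (hasFDerivAt_norm_rpow (z + (t : ℂ) * w)
    (by linarith : 1 < p + 1)).comp_hasDerivAt t h1
  refine h2.congr_deriv ?_
  have e : p + 1 - 2 = p - 1 := by ring
  rw [e, smul_apply, smul_eq_mul, innerSL_apply_apply, Complex.inner]
  congr 1
  simp only [Complex.mul_re, Complex.conj_re, Complex.conj_im]
  ring

theorem add_rpow_le {p : ℝ} (hp : 1 < p) {a b : ℝ} (ha : 0 ≤ a) (hb : 0 ≤ b) :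
    (a + b) ^ (p + 1) ≤ 2 ^ (p + 1) * (a ^ (p + 1) + b ^ (p + 1)) := by
  have hq : 0 ≤ p + 1 := by linarith
  have h1 : a + b ≤ 2 * max a b := by linarith [le_max_left a b, le_max_right a b]
  have h2 := Real.rpow_le_rpow (by positivity) h1 hq
  rw [Real.mul_rpow (by norm_num) (le_max_of_le_left ha)] at h2
  refine h2.trans (mul_le_mul_of_nonneg_left ?_ (by positivity))
  rcases le_total a b with h | h
  · rw [max_eq_right h]
    have : 0 ≤ a ^ (p + 1) := by positivity
    linarith
  · rw [max_eq_left h]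
    have : 0 ≤ b ^ (p + 1) := by positivity
    linarith

theorem rpow_mul_mul_le {p : ℝ} (hp : 1 < p) {r a b : ℝ} (hr : 0 ≤ r) (hb : 0 ≤ b) (ha : 0 ≤ a)
    (h : r ≤ a + b) :
    r ^ (p - 1) * (r * b) ≤ 2 ^ (p + 1) * (a ^ (p + 1) + b ^ (p + 1)) := by
  refine le_trans ?_ (add_rpow_le hp ha hb)
  rcases hr.eq_or_lt with rfl | hr0
  · rw [zero_mul, mul_zero]; positivity
  · have hs : 0 < a + b := hr0.trans_le h
    have e : (a + b) ^ (p + 1) = (a + b) ^ (p - 1) * ((a + b) * (a + b)) := by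
      rw [← sq, ← Real.rpow_natCast (a + b) 2, ← Real.rpow_add hs]
      congr 1
      push_cast
      ring
    rw [e]
    have h1 : r ^ (p - 1) ≤ (a + b) ^ (p - 1) := Real.rpow_le_rpow hr h (by linarith)
    have h2 : r * b ≤ (a + b) * (a + b) := mul_le_mul h (by linarith) hb hs.le
    exact mul_le_mul h1 h2 (by positivity) (by positivity)

theorem aestronglyMeasurable_nonlinear (p : ℝ) (φ v : L2 d) (t : ℝ) :
    AEStronglyMeasurable (fun x => ((‖φ x + (t : ℂ) * v x‖ ^ (p - 1) : ℝ) : ℂ)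
      * (φ x + (t : ℂ) * v x) * conj (v x)) (volume : Measure (Space d)) := by
  have h1 : AEStronglyMeasurable (fun x => φ x + (t : ℂ) * v x) (volume : Measure (Space d)) :=
    (Lp.aestronglyMeasurable φ).add ((Lp.aestronglyMeasurable v).const_mul _)
  exact ((Complex.measurable_ofReal.comp_aemeasurable
    (h1.norm.aemeasurable.pow_const _)).aestronglyMeasurable.mul h1).mul
      (Lp.aestronglyMeasurable v).star

theorem integrable_nonlinear_mul_conj {p : ℝ} (hp : 1 < p) {φ v : L2 d}
    (hφ : Integrable fun x => ‖φ x‖ ^ (p + 1)) (hv : Integrable fun x => ‖v x‖ ^ (p + 1)) :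
    Integrable fun x => ((‖φ x‖ ^ (p - 1) : ℝ) : ℂ) * φ x * conj (v x) := by
  refine Integrable.mono' ((hφ.add hv).const_mul (2 ^ (p + 1))) ?_ (.of_forall fun x => ?_)
  · simpa using aestronglyMeasurable_nonlinear p φ v 0
  · rw [norm_mul, norm_mul, Complex.norm_real, RCLike.norm_conj,
      Real.norm_of_nonneg (by positivity), mul_assoc]
    exact rpow_mul_mul_le hp (norm_nonneg _) (norm_nonneg _) (norm_nonneg _)
      (by linarith [norm_nonneg (v x)])

/-- The nonlinear term is differentiable along lines. -/
theorem hasDerivAt_integral_norm_rpow {p : ℝ} (hp : 1 < p) {φ v : L2 d}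
    (hφ : Integrable fun x => ‖φ x‖ ^ (p + 1)) (hv : Integrable fun x => ‖v x‖ ^ (p + 1)) :
    HasDerivAt (fun t : ℝ => ∫ x, ‖(φ + (t : ℂ) • v : L2 d) x‖ ^ (p + 1))
      ((p + 1) * (∫ x, ((‖φ x‖ ^ (p - 1) : ℝ) : ℂ) * φ x * conj (v x)).re) 0 := by
  have e1 : (fun t : ℝ => ∫ x, ‖(φ + (t : ℂ) • v : L2 d) x‖ ^ (p + 1))
      = fun t : ℝ => ∫ x, ‖φ x + (t : ℂ) * v x‖ ^ (p + 1) := by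
    funext t
    refine integral_congr_ae ?_
    filter_upwards [Lp.coeFn_add φ ((t : ℂ) • v), Lp.coeFn_smul (t : ℂ) v] with x h1 h2
    rw [h1, Pi.add_apply, h2, Pi.smul_apply, smul_eq_mul]
  have hm : ∀ t : ℝ, AEStronglyMeasurable (fun x => φ x + (t : ℂ) * v x)
      (volume : Measure (Space d)) := fun t =>
    (Lp.aestronglyMeasurable φ).add ((Lp.aestronglyMeasurable v).const_mul _)
  set F' : ℝ → Space d → ℝ := fun t x =>
    (p + 1) * ‖φ x + (t : ℂ) * v x‖ ^ (p - 1) * ((φ x + (t : ℂ) * v x) * conj (v x)).re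
  have key := hasDerivAt_integral_of_dominated_loc_of_deriv_le (μ := (volume : Measure (Space d)))
    (F := fun (t : ℝ) x => ‖φ x + (t : ℂ) * v x‖ ^ (p + 1)) (F' := F') (x₀ := 0)
    (s := Metric.ball 0 1)
    (bound := fun x => (p + 1) * (2 ^ (p + 1) * (‖φ x‖ ^ (p + 1) + ‖v x‖ ^ (p + 1))))
    (Metric.ball_mem_nhds 0 one_pos)
    (.of_forall fun t => ((hm t).norm.aemeasurable.pow_const _).aestronglyMeasurable)
    (by simpa using hφ) ?_ (.of_forall fun x t ht => ?_)
    (((hφ.add hv).const_mul _).const_mul _)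
    (.of_forall fun x t _ => hasDerivAt_norm_rpow_line hp (φ x) (v x) t)
  · rw [e1]
    refine key.2.congr_deriv ?_
    have hre := integral_re (integrable_nonlinear_mul_conj hp hφ hv)
    simp only [RCLike.re_to_complex] at hre
    rw [← hre, ← integral_const_mul (p + 1)]
    refine integral_congr_ae (.of_forall fun x => ?_)
    simp only [F', Complex.ofReal_zero, zero_mul, add_zero, mul_assoc, Complex.re_ofReal_mul]
  · have := (Complex.continuous_re.comp_aestronglyMeasurable
      (aestronglyMeasurable_nonlinear p φ v 0)).const_mul (p + 1)
    refine this.congr (.of_forall fun x => ?_)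
    simp only [F', mul_assoc, Complex.re_ofReal_mul]
  · have ht1 : |t| ≤ 1 := by
      have : |t| < 1 := by simpa using ht
      exact this.le
    have h1 : ‖φ x + (t : ℂ) * v x‖ ≤ ‖φ x‖ + ‖v x‖ := by
      refine (norm_add_le _ _).trans (add_le_add le_rfl ?_)
      rw [norm_mul, Complex.norm_real]
      exact mul_le_of_le_one_left (norm_nonneg _) ht1
    have h2 : |((φ x + (t : ℂ) * v x) * conj (v x)).re| ≤ ‖φ x + (t : ℂ) * v x‖ * ‖v x‖ := by
      refine (Complex.abs_re_le_norm _).trans (le_of_eq ?_)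
      rw [norm_mul, RCLike.norm_conj]
    simp only [F']
    rw [norm_mul, norm_mul, Real.norm_of_nonneg (by linarith : 0 ≤ p + 1),
      Real.norm_of_nonneg (by positivity), mul_assoc, Real.norm_eq_abs]
    refine mul_le_mul_of_nonneg_left ?_ (by linarith)
    exact (mul_le_mul_of_nonneg_left h2 (by positivity)).trans
      (rpow_mul_mul_le hp (norm_nonneg _) (norm_nonneg _) (norm_nonneg _) h1)

/-- The first variation of the action at `φ` in the direction `v`. -/
noncomputable def firstVariation (p : ℝ) (V : Space d → ℝ) (β Ω ω : ℝ) (φ v : L2 d) : ℂ :=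
  linearForm V Ω φ v + (β : ℂ) * (∫ x, ((‖φ x‖ ^ (p - 1) : ℝ) : ℂ) * φ x * conj (v x))
    + (ω : ℂ) * (∫ x, φ x * conj (v x))

theorem isStationary_iff {p : ℝ} {V : Space d → ℝ} {β Ω ω : ℝ} {φ : L2 d} :
    IsStationary p V β Ω ω φ ↔
      φ ∈ energySpace V ∧ ∀ v ∈ energySpace V, firstVariation p V β Ω ω φ v = 0 := by
  refine and_congr_right fun _ => forall₂_congr fun v _ => ?_
  rw [firstVariation, linearForm]
  ring_nf

theorem firstVariation_smul {p : ℝ} {V : Space d → ℝ} {β Ω ω : ℝ} (hR : ControlsRotation V Ω)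
    {φ v : L2 d} (c : ℂ) (hφ : φ ∈ energySpace V) (hv : v ∈ energySpace V) :
    firstVariation p V β Ω ω φ (c • v) = conj c * firstVariation p V β Ω ω φ v := by
  have h1 : ∀ F : Space d → ℂ, ∫ x, F x * conj ((c • v : L2 d) x)
      = conj c * ∫ x, F x * conj (v x) := fun F => by
    rw [← integral_const_mul]
    refine integral_congr_ae ?_
    filter_upwards [Lp.coeFn_smul c v] with x hx
    rw [hx, Pi.smul_apply, smul_eq_mul, map_mul]
    ring
  rw [firstVariation, firstVariation, linearForm_smul_right hR c hφ hv, h1, h1]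
  ring

/-- Minimizers of the action on the energy space are stationary. -/
theorem isStationary_of_minimizer {p : ℝ} (hp : 1 < p)
    (hpd : 3 ≤ d → p < ((d : ℝ) + 2) / ((d : ℝ) - 2)) {V : Space d → ℝ}
    (hVm : AEMeasurable V volume) (hV0 : ∀ x, 0 ≤ V x) {β Ω ω : ℝ}
    (hR : ControlsRotation V Ω) {u : L2 d} (hu : u ∈ energySpace V)
    (hmin : ∀ χ ∈ energySpace V, action p V β Ω ω u ≤ action p V β Ω ω χ) :
    IsStationary p V β Ω ω u := by
  have hre : ∀ v ∈ energySpace V, (firstVariation p V β Ω ω u v).re = 0 := by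
    intro v hv
    have hN := (hasDerivAt_integral_norm_rpow hp (integrable_nonlinear hp hpd hu)
      (integrable_nonlinear hp hpd hv)).const_mul (2 * β / (p + 1))
    have hnsq : ∀ t : ℝ, ‖u + (t : ℂ) • v‖ ^ 2
        = ‖u‖ ^ 2 + 2 * (t * (∫ x, u x * conj (v x)).re) + t ^ 2 * ‖v‖ ^ 2 := fun t => by
      have h1 : ‖u + (t : ℂ) • v‖ ^ 2 = ‖u‖ ^ 2 + 2 * (inner ℂ u ((t : ℂ) • v) : ℂ).re
        + ‖(t : ℂ) • v‖ ^ 2 := norm_add_sq (𝕜 := ℂ) _ _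
      rw [h1, inner_smul_right, Complex.re_ofReal_mul, norm_smul, mul_pow, Complex.norm_real,
        Real.norm_eq_abs, sq_abs, integral_mul_conj_eq_inner, ← inner_conj_symm u v,
        Complex.conj_re]
    have hL : ∀ t : ℝ, linearEnergy V Ω (u + (t : ℂ) • v) = linearEnergy V Ω u
        + 2 * (t * (linearForm V Ω u v).re) + t ^ 2 * linearEnergy V Ω v := fun t => by
      rw [linearEnergy_add hVm hV0 hR hu (energySpace_smul _ hv), linearEnergy_smul hR _ hv,
        linearForm_smul_right hR _ hu hv, Complex.conj_ofReal, Complex.re_ofReal_mul,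
        Complex.norm_real, Real.norm_eq_abs, sq_abs]
    have hquad : ∀ A B C : ℝ, HasDerivAt (fun t : ℝ => A + 2 * (t * B) + t ^ 2 * C) (2 * B) 0 := by
      intro A B C
      have h1 := (((hasDerivAt_id (0 : ℝ)).mul_const B).const_mul 2).const_add A
      have h2 := ((hasDerivAt_id (0 : ℝ)).pow 2).mul_const C
      exact (h1.add h2).congr_deriv (by simp)
    have hd : HasDerivAt (fun t : ℝ => action p V β Ω ω (u + (t : ℂ) • v))
        (2 * (firstVariation p V β Ω ω u v).re) 0 := by
      have h1 := ((hquad (linearEnergy V Ω u) (linearForm V Ω u v).re (linearEnergy V Ω v)).add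
        hN).add ((hquad (‖u‖ ^ 2) (∫ x, u x * conj (v x)).re (‖v‖ ^ 2)).const_mul ω)
      refine (h1.congr_of_eventuallyEq (.of_forall fun t => ?_)).congr_deriv ?_
      · simp only [action, energy, hnsq, hL, Pi.add_apply]
      · simp only [firstVariation, Complex.add_re, Complex.re_ofReal_mul]
        field_simp
    have hloc : IsLocalMin (fun t : ℝ => action p V β Ω ω (u + (t : ℂ) • v)) 0 := by
      refine .of_forall fun t => ?_
      simpa using hmin _ (energySpace_add hVm hV0 hu (energySpace_smul (t : ℂ) hv))
    have := hloc.hasDerivAt_eq_zero hd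
    linarith
  refine isStationary_iff.2 ⟨hu, fun v hv => Complex.ext (hre v hv) ?_⟩
  -- the imaginary part is the real part in the direction `i v`
  have h1 := hre _ (energySpace_smul Complex.I hv)
  rw [firstVariation_smul hR _ hu hv] at h1
  simpa using h1

/-! ### Action ground states -/

/-- Below `-λ₀` the action takes negative values: scale a function with negative quadratic part
down, so that the nonlinear term becomes negligible. -/
theorem exists_action_neg {p : ℝ} (hp : 1 < p) {V : Space d → ℝ} {β : ℝ} (hβ : 0 < β) {Ω : ℝ}
    (hR : ControlsRotation V Ω) {ω : ℝ} (hω : (ω : EReal) < -lambda0 V Ω) :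
    ∃ φ ∈ energySpace V, action p V β Ω ω φ < 0 := by
  have h1 : lambda0 V Ω < ((-ω : ℝ) : EReal) := by
    rw [EReal.coe_neg]
    exact EReal.lt_neg_comm.1 hω
  obtain ⟨_, ⟨φ, ⟨hφ, hφ0⟩, rfl⟩, h2⟩ := sInf_lt_iff.1 h1
  have h3 : linearEnergy V Ω φ / ‖φ‖ ^ 2 < -ω := EReal.coe_lt_coe_iff.1 h2
  have hm : 0 < ‖φ‖ := norm_pos_iff.2 hφ0
  rw [div_lt_iff₀ (by positivity)] at h3
  set δ : ℝ := -(linearEnergy V Ω φ + ω * ‖φ‖ ^ 2)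
  have hδ : 0 < δ := by simp only [δ]; linarith
  set N : ℝ := 2 * β / (p + 1) * ∫ x, ‖φ x‖ ^ (p + 1)
  have hN : 0 ≤ N := mul_nonneg (by positivity) (integral_nonneg fun x => by positivity)
  set t : ℝ := (δ / (N + 1)) ^ (1 / (p - 1))
  have ht : 0 < t := by positivity
  have htp : t ^ (p - 1) * (N + 1) = δ := by
    rw [← Real.rpow_mul (by positivity), one_div_mul_cancel (by linarith), Real.rpow_one]
    field_simp
  refine ⟨(t : ℂ) • φ, energySpace_smul _ hφ, ?_⟩
  have e1 : ‖(t : ℂ)‖ = t := by rw [Complex.norm_real, Real.norm_of_nonneg ht.le]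
  have e2 : t ^ (p + 1) = t ^ 2 * t ^ (p - 1) := by
    rw [← Real.rpow_natCast t 2, ← Real.rpow_add ht]
    congr 1
    push_cast
    ring
  have e3 : action p V β Ω ω ((t : ℂ) • φ) = t ^ 2 * (t ^ (p - 1) * N - δ) := by
    rw [action, energy, linearEnergy_smul hR _ hφ, integral_norm_rpow_smul, norm_smul, e1, e2]
    simp only [N, δ]
    ring
  have h4 : 0 < t ^ (p - 1) := by positivity
  rw [e3]
  exact mul_neg_of_pos_of_neg (by positivity) (by linarith)

theorem action_zero {p : ℝ} (hp : 1 < p) {V : Space d → ℝ} {β Ω : ℝ}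
    (hR : ControlsRotation V Ω) {φ : L2 d} (hφ : φ ∈ energySpace V) (ω : ℝ) :
    action p V β Ω ω 0 = 0 := by
  have e : (0 : L2 d) = (0 : ℂ) • φ := (zero_smul ℂ φ).symm
  rw [e, action, energy, linearEnergy_smul hR _ hφ, integral_norm_rpow_smul, norm_smul, norm_zero,
    Real.zero_rpow (by linarith)]
  simp

/-- Below `-λ₀`, action ground states exist, and they minimize the action on the whole energy
space: the global minimizer is a nonzero stationary state. -/
theorem actionGroundStates_spec {p : ℝ} (hp : 1 < p)
    (hpd : 3 ≤ d → p < ((d : ℝ) + 2) / ((d : ℝ) - 2)) {V : Space d → ℝ}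
    (hVm : AEMeasurable V volume) (hV0 : ∀ x, 0 ≤ V x)
    (hV : Tendsto V (cocompact (Space d)) atTop) {β : ℝ} (hβ : 0 < β) {Ω : ℝ}
    (hR : ControlsRotation V Ω) {ω : ℝ} (hω : (ω : EReal) < -lambda0 V Ω) :
    (actionGroundStates p V β Ω ω).Nonempty ∧ ∀ φ ∈ actionGroundStates p V β Ω ω,
      ∀ χ ∈ energySpace V, action p V β Ω ω φ ≤ action p V β Ω ω χ := by
  obtain ⟨ψ, hψ, hneg⟩ := exists_action_neg hp hβ hR hω
  obtain ⟨u, hu, hmin⟩ := exists_minimizer hp hpd hVm hV0 hV hβ hR ω ⟨ψ, hψ⟩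
  have hu0 : u ≠ 0 := by
    rintro rfl
    have := hmin ψ hψ
    rw [action_zero hp hR hψ] at this
    linarith
  have hus := isStationary_of_minimizer hp hpd hVm hV0 hR hu hmin
  exact ⟨⟨u, ⟨hu0, hus⟩, fun χ _ hχ => hmin χ hχ.1⟩,
    fun φ hφ χ hχ => (hφ.2 u hu0 hus).trans (hmin χ hχ)⟩

/-- A nonzero function is stationary for at most one frequency. -/
theorem IsStationary.eq_omega {p : ℝ} {V : Space d → ℝ} {β Ω ω₁ ω₂ : ℝ} {φ : L2 d} (h0 : φ ≠ 0)
    (h1 : IsStationary p V β Ω ω₁ φ) (h2 : IsStationary p V β Ω ω₂ φ) : ω₁ = ω₂ := by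
  have e1 := h1.2 φ h1.1
  have e2 := h2.2 φ h1.1
  have e3 : ((ω₁ : ℂ) - ω₂) * ∫ x, φ x * conj (φ x) = 0 := by linear_combination e1 - e2
  rw [integral_mul_conj_eq_inner] at e3
  rcases mul_eq_zero.1 e3 with h | h
  · exact_mod_cast sub_eq_zero.1 h
  · exact absurd (inner_self_eq_zero.1 h) h0

/-- The mass of action ground states decreases strictly in `ω`. -/
theorem mass_lt_of_lt {p : ℝ} (hp : 1 < p)
    (hpd : 3 ≤ d → p < ((d : ℝ) + 2) / ((d : ℝ) - 2)) {V : Space d → ℝ}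
    (hVm : AEMeasurable V volume) (hV0 : ∀ x, 0 ≤ V x)
    (hV : Tendsto V (cocompact (Space d)) atTop) {β : ℝ} (hβ : 0 < β) {Ω : ℝ}
    (hR : ControlsRotation V Ω) {ω₁ ω₂ : ℝ} (hlt : ω₁ < ω₂)
    (hω₂ : (ω₂ : EReal) < -lambda0 V Ω) {φ₁ φ₂ : L2 d}
    (h₁ : φ₁ ∈ actionGroundStates p V β Ω ω₁) (h₂ : φ₂ ∈ actionGroundStates p V β Ω ω₂) :
    ‖φ₂‖ ^ 2 < ‖φ₁‖ ^ 2 := by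
  have hω₁ : (ω₁ : EReal) < -lambda0 V Ω := (EReal.coe_lt_coe_iff.2 hlt).trans hω₂
  have m₁ := (actionGroundStates_spec hp hpd hVm hV0 hV hβ hR hω₁).2 φ₁ h₁
  have m₂ := (actionGroundStates_spec hp hpd hVm hV0 hV hβ hR hω₂).2 φ₂ h₂
  have i1 := m₁ φ₂ h₂.1.2.1
  have i2 := m₂ φ₁ h₁.1.2.1
  rw [action, action] at i1 i2
  by_contra! hle
  -- both inequalities are then equalities, so `φ₂` also minimizes the action at `ω₁`
  have hmin : ∀ χ ∈ energySpace V, action p V β Ω ω₁ φ₂ ≤ action p V β Ω ω₁ χ := by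
    refine fun χ hχ => le_trans ?_ (m₁ χ hχ)
    rw [action, action]
    nlinarith
  have hs := isStationary_of_minimizer hp hpd hVm hV0 hR h₂.1.2.1 hmin
  exact hlt.ne (hs.eq_omega h₂.1.1 h₂.1.2)

end RNLS

theorem corollary4p4 (d : ℕ) (hd : 1 ≤ d) (p : ℝ) (hp : 1 < p)
    (hpd : 3 ≤ d → p < ((d : ℝ) + 2) / ((d : ℝ) - 2))
    (V : RNLS.Space d → ℝ) (hVm : AEMeasurable V volume) (hV0 : ∀ x, 0 ≤ V x)
    (hV : Tendsto V (cocompact (RNLS.Space d)) atTop)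
    (β : ℝ) (hβ : 0 < β)
    (Ω : ℝ) (hΩ : Ω = 0 ∨ (0 < |Ω| ∧ ((|Ω| : ℝ) : EReal) < RNLS.maxSpeed V)) :
    StrictAntiOn (RNLS.lowerMass p V β Ω) {ω : ℝ | (ω : EReal) < -RNLS.lambda0 V Ω} ∧
    StrictAntiOn (RNLS.upperMass p V β Ω) {ω : ℝ | (ω : EReal) < -RNLS.lambda0 V Ω} ∧
    (∀ ω : ℝ, (ω : EReal) < -RNLS.lambda0 V Ω →
      RNLS.lowerMass p V β Ω ω ≤ RNLS.upperMass p V β Ω ω) ∧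
    (∀ ω₁ ω₂ : ℝ, ω₁ < ω₂ → (ω₂ : EReal) < -RNLS.lambda0 V Ω →
      RNLS.upperMass p V β Ω ω₂ < RNLS.lowerMass p V β Ω ω₁) := by
  have hR := RNLS.controlsRotation_of_lt_maxSpeed hV0 hΩ
  have hne : ∀ ω : ℝ, (ω : EReal) < -RNLS.lambda0 V Ω →
      (RNLS.actionGroundStates p V β Ω ω).Nonempty := fun ω hω =>
    (RNLS.actionGroundStates_spec hp hpd hVm hV0 hV hβ hR hω).1
  have hle : ∀ {ω : ℝ} {φ : RNLS.L2 d}, φ ∈ RNLS.actionGroundStates p V β Ω ω →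
      RNLS.lowerMass p V β Ω ω ≤ ((‖φ‖ ^ 2 : ℝ) : EReal) ∧
        ((‖φ‖ ^ 2 : ℝ) : EReal) ≤ RNLS.upperMass p V β Ω ω := fun hφ =>
    ⟨sInf_le (Set.mem_image_of_mem _ (Set.mem_image_of_mem _ hφ)),
      le_sSup (Set.mem_image_of_mem _ (Set.mem_image_of_mem _ hφ))⟩
  have hlu : ∀ ω : ℝ, (ω : EReal) < -RNLS.lambda0 V Ω →
      RNLS.lowerMass p V β Ω ω ≤ RNLS.upperMass p V β Ω ω := fun ω hω => by
    obtain ⟨φ, hφ⟩ := hne ω hω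
    exact (hle hφ).1.trans (hle hφ).2
  -- two intermediate frequencies turn the strict inequality between masses of single ground
  -- states into a strict inequality between the supremum and the infimum
  have hul : ∀ ω₁ ω₂ : ℝ, ω₁ < ω₂ → (ω₂ : EReal) < -RNLS.lambda0 V Ω →
      RNLS.upperMass p V β Ω ω₂ < RNLS.lowerMass p V β Ω ω₁ := by
    intro ω₁ ω₂ hlt hω₂
    obtain ⟨s, hs1, hs2⟩ := exists_between hlt
    obtain ⟨r, hr1, hr2⟩ := exists_between hs1
    have hsω : (s : EReal) < -RNLS.lambda0 V Ω := (EReal.coe_lt_coe_iff.2 hs2).trans hω₂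
    have hrω : (r : EReal) < -RNLS.lambda0 V Ω := (EReal.coe_lt_coe_iff.2 hr2).trans hsω
    obtain ⟨φ, hφ⟩ := hne r hrω
    obtain ⟨ψ, hψ⟩ := hne s hsω
    have h1 : RNLS.upperMass p V β Ω ω₂ ≤ ((‖ψ‖ ^ 2 : ℝ) : EReal) := by
      refine sSup_le ?_
      rintro _ ⟨_, ⟨χ, hχ, rfl⟩, rfl⟩
      exact EReal.coe_le_coe_iff.2
        (RNLS.mass_lt_of_lt hp hpd hVm hV0 hV hβ hR hs2 hω₂ hψ hχ).le
    have h2 : ((‖φ‖ ^ 2 : ℝ) : EReal) ≤ RNLS.lowerMass p V β Ω ω₁ := by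
      refine le_sInf ?_
      rintro _ ⟨_, ⟨χ, hχ, rfl⟩, rfl⟩
      exact EReal.coe_le_coe_iff.2
        (RNLS.mass_lt_of_lt hp hpd hVm hV0 hV hβ hR hr1 hrω hχ hφ).le
    exact (h1.trans_lt (EReal.coe_lt_coe_iff.2
      (RNLS.mass_lt_of_lt hp hpd hVm hV0 hV hβ hR hr2 hsω hφ hψ))).trans_le h2
  refine ⟨fun ω₁ h₁ ω₂ h₂ hlt => (hlu ω₂ h₂).trans_lt (hul ω₁ ω₂ hlt h₂),
    fun ω₁ h₁ ω₂ h₂ hlt => (hul ω₁ ω₂ hlt h₂).trans_le (hlu ω₁ h₁), hlu, hul⟩
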